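/- Let $k\ge 3$. **Graphs.** The odd graph $O_k$ has as vertices the $k$-subsets of $\{0,\dots,2k\}$ (identified with binary strings of length $2k+1$, coordinates numbered $0,\dots,2k$ from the left), two of them being adjacent iff they are disjoint. The middle-levels graph $M_k$ has as vertices the $k$- and the $(k+1)$-subsets of $\{0,\dots,2k\}$, adjacency being strict inclusion. The 2-covering map $\Psi:M_k\to O_k$ is the identity on $k$-subsets and $B\mapsto\{0,\dots,2k\}\setminus B$ on $(k+1)$-subsets. **Lists.** A Dyck word is a balanced $0/1$-word each of whose prefixes has at least as many $0$s as $1$s; $D_k$ is the set of Dyck words of length $2k$. For $f\in D_k$ define a string $p=p(1)\cdots p(2k)$ as follows: start with $1,2,\dots,2k$ written under the letters of $f$; write $f$ as a concatenation of blocks $0g1$ with $g$ a Dyck word; reverse the part of the string under each block; then repeat the same with the part of the string now under each inner word $g$, and so on recursively. Put $\pi=p^{-1}$. The list $L(f)=(v_0,\dots,v_{2k})$ of vertices of $O_k$ starts with $v_0=0f$, and $v_{i+1}$ is the neighbour of $v_i$ such that $\pi(2k-i)$ is the only coordinate at which both $v_i,v_{i+1}$ are $0$ ($0\le i<2k$);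 it is closed to a cycle by the edge $v_{2k}v_0$, which uses coordinate $0$. The set of all edges of these cycles, $f\in D_k$, is the uniform 2-factor $\mathcal U_k$ of $O_k$. The lifted lists form the 2-factor $\mathcal U^M_k=\Psi^{-1}(\mathcal U_k)$ of $M_k$. For $f\in D_k$ and a position $j$ counted from the right (starting with $0$), the flippable tuple $FT(f,j)$ is the edge of $L(f)$ that uses the coordinate at position $j$ from the right. **The hypergraph $H_k$.** Consider the following collections of Dyck words with one underlined entry, $w$ being any Dyck word, possibly empty: $$\begin{aligned}S_1(w)&=\{0w001\underline11,\ 0w\underline01101,\ 0w0101\underline1\},&S_2&=\{0\underline0110011,\ 0010011\underline1,\ 00010\underline111\},\\ S_3&=\{00011\underline1,\ 0100\underline11,\ \underline010101\},&S_4&=\{00011\underline1,\ 0010\underline11,\ 01\underline0011,\ \underline010101\},\end{aligned}$$ and the collections $\underline S_1(w),\underline S_2,\underline S_3,\underline S_4$ obtained from them by reversing and complementing every word, the underlined positions being reversed too. $H_k$ is the hypergraph on the lists $L(f)$, $f\in D_k$, whose hyperedges are the sets $\{uxv : x\in S\}$, where $S$ is one of these collections and $u,v$ are fixed strings such that $uxv\in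 D_k$ for all $x\in S$; each vertex of a hyperedge carries the position (from the right) of the underlined entry of $uxv$. A set $T$ of hyperedges is a *spanning tree* of $H_k$ if every list lies in a member of $T$, the graph obtained by replacing each member of $T$ by the clique on its vertices is connected, and each cycle of that graph lies in the clique of exactly one member of $T$. $T$ is *conflict-free* if any two distinct members share at most one vertex and carry different positions at a shared vertex. **Flipping cycles.** A flipping cycle of a hyperedge $h$ is a cycle of length $2|h|$ in $O_k$ containing the flippable tuples $FT(f,j)$ of all members $(f,j)$ of $h$, these being pairwise disjoint edges, in different lists and with different positions. A lift of a cycle $C$ of $O_k$ is a cycle of $M_k$ that $\Psi$ maps bijectively (on edges) onto $C$. **Claim.** Every hyperedge of $H_k$ has a flipping cycle, and every flipping cycle of a hyperedge has a lift to $M_k$. Let $T$ be any conflict-free spanning tree of $H_k$ and, for each $h\in T$, let $C_h$ be any flipping cycle of $h$. Then the symmetric difference $\mathcal U_k\,\triangle\,\bigcup_{h\in T}E(C_h)$ is the edge set of a Hamilton cycle of $O_k$, and to it corresponds a Hamilton cycle of $M_k$: for any choice of one lift $C'_h$ of $C_h$ for each $h\in T$, the symmetric difference $\mathcal U^M_k\,\triangle\,\bigcup_{h\in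 T}E(C'_h)$ is the edge set of a Hamilton cycle of $M_k$. -/

import Mathlib

/-! Conventions: a Dyck word is Mathlib's `DyckWord`, where `U` is the bit `0` and `D` is the
bit `1`. Coordinates of binary strings of length `2k + 1` are numbered `0, …, 2k` from the left. -/

namespace MiddleLevels

/-! ### The odd graph, the middle-levels graph and the covering map -/

/-- The `k`-subsets of `{0, …, 2k}`. -/
abbrev OddVertex (k : ℕ) : Type := {s : Finset (Fin (2 * k + 1)) // s.card = k}

/-- The odd graph `O_k`: two (different) `k`-subsets are adjacent if they are disjoint. -/
def oddGraph (k : ℕ) : SimpleGraph (OddVertex k) where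
  Adj a b := a ≠ b ∧ Disjoint a.1 b.1
  symm := ⟨fun _ _ h => ⟨h.1.symm, h.2.symm⟩⟩
  loopless := ⟨fun _ h => h.1 rfl⟩

/-- The `k`-subsets and the `(k+1)`-subsets of `{0, …, 2k}`. -/
abbrev MiddleVertex (k : ℕ) : Type :=
  {s : Finset (Fin (2 * k + 1)) // s.card = k ∨ s.card = k + 1}

/-- The middle-levels graph `M_k`: adjacency is strict inclusion. -/
def middleGraph (k : ℕ) : SimpleGraph (MiddleVertex k) where
  Adj a b := a.1 ⊂ b.1 ∨ b.1 ⊂ a.1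
  symm := ⟨fun _ _ h => h.symm⟩
  loopless := ⟨fun a h => h.elim (ssubset_irrefl a.1) (ssubset_irrefl a.1)⟩

/-- The 2-covering map `M_k → O_k`: the identity on `k`-subsets, and complementation on
`(k+1)`-subsets. -/
def covering (k : ℕ) (a : MiddleVertex k) : OddVertex k :=
  if h : a.1.card = k then ⟨a.1, h⟩
  else ⟨a.1ᶜ, by
    have h1 := a.2
    have h2 := Finset.card_compl a.1
    rw [Fintype.card_fin] at h2
    omega⟩

/-- `C` is the edge set of a cycle of `G`. -/
def IsCycleEdgeSet {V : Type*} (G : SimpleGraph V) (C : Set (Sym2 V)) : Prop :=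
  ∃ (v : V) (p : G.Walk v v), p.IsCycle ∧ {e | e ∈ p.edges} = C

/-- `C` is the edge set of a Hamilton cycle of `G`. -/
def IsHamiltonCycleEdgeSet {V : Type*} [DecidableEq V] (G : SimpleGraph V)
    (C : Set (Sym2 V)) : Prop :=
  ∃ (v : V) (p : G.Walk v v), p.IsHamiltonianCycle ∧ {e | e ∈ p.edges} = C

/-! ### The permutation of a Dyck word, the lists and the uniform 2-factors -/

/-- Dyck words of length `2k`. -/
abbrev Word (k : ℕ) : Type := {f : DyckWord // f.semilength = k}

/-- Write `f` as a concatenation of blocks `0 g 1` with `g` a Dyck word, and let `l` be the string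
of numbers written under the letters of `f`. Reverse the part of `l` under each block, and then
proceed in the same way with the string that is now under the word `g` inside the block. -/
def rearrange (f : DyckWord) (l : List ℕ) : List ℕ :=
  if _h : f = 0 then []
  else
    let m := f.insidePart.toList.length
    let r := (l.take (m + 2)).reverse
    r.take 1 ++ rearrange f.insidePart ((r.drop 1).take m) ++ r.drop (m + 1) ++
      rearrange f.outsidePart (l.drop (m + 2))
termination_by f.semilength
decreasing_by
  · exact DyckWord.semilength_insidePart_lt _h
  · exact DyckWord.semilength_outsidePart_lt _h

/-- The permutation `p = p(1) ⋯ p(2k)` of `1, …, 2k`, as a string. -/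
def permString {k : ℕ} (f : Word k) : List ℕ := rearrange f.1 (List.range' 1 (2 * k))

/-- The coordinate used by step `i` of the list of `f`: for `i < 2k` it is entry `i + 1` of the
reverse of `π = p⁻¹`, that is `π(2k - i)`; the closing step `i = 2k` uses coordinate `0`. -/
def stepCoord {k : ℕ} (f : Word k) (i : ℕ) : ℕ :=
  if i < 2 * k then (permString f).idxOf (2 * k - i) + 1 else 0

/-- Entry `i` of the list `L(f)`, as the support of a binary string of length `2k + 1`. The list
starts with `0f`, and each step leads to the neighbour in `O_k` for which the step's coordinate is
the only one lying in neither of the two supports. -/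
def listEntry {k : ℕ} (f : Word k) : ℕ → Finset (Fin (2 * k + 1))
  | 0 => Finset.univ.filter fun c => (DyckStep.U :: f.1.toList)[c.val]? = some DyckStep.D
  | i + 1 => Finset.univ.filter fun c => c ∉ listEntry f i ∧ c.val ≠ stepCoord f i

/-- `e` is the pair of (cyclically) contiguous entries `i`, `i + 1` of the list `L(f)`. -/
def IsListEdge {k : ℕ} (f : Word k) (i : ℕ) (e : Sym2 (OddVertex k)) : Prop :=
  i ≤ 2 * k ∧ ∃ a b : OddVertex k,
    a.1 = listEntry f i ∧ b.1 = listEntry f ((i + 1) % (2 * k + 1)) ∧ e = s(a, b)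

/-- The uniform 2-factor of `O_k` formed by the lists. -/
def oddFactor (k : ℕ) : Set (Sym2 (OddVertex k)) :=
  {e | ∃ (f : Word k) (i : ℕ), IsListEdge f i e}

/-- The uniform 2-factor of `M_k` formed by the lifted lists: the edges of `M_k` over the edges of
the uniform 2-factor of `O_k`. -/
def middleFactor (k : ℕ) : Set (Sym2 (MiddleVertex k)) :=
  {e | e ∈ (middleGraph k).edgeSet ∧ e.map (covering k) ∈ oddFactor k}

/-! ### The hypergraph `H_k` -/

/-- A Dyck word (standing for its list) with a position, counted from the right and from `0`. -/
abbrev MarkedWord (k : ℕ) : Type := Word k × ℕ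

/-- The string of steps of a string of bits. -/
def bits (l : List ℕ) : List DyckStep := l.map fun b => if b = 0 then DyckStep.U else DyckStep.D

/-- The triple `S_1(w)`; each string comes with its underlined position. -/
def S1 (w : DyckWord) : List (List DyckStep × ℕ) :=
  [(bits [0] ++ w.toList ++ bits [0, 0, 1, 1, 1], 1),
   (bits [0] ++ w.toList ++ bits [0, 1, 1, 0, 1], 4),
   (bits [0] ++ w.toList ++ bits [0, 1, 0, 1, 1], 0)]

/-- The triple `S_2`. -/
def S2 : List (List DyckStep × ℕ) :=
  [(bits [0, 0, 1, 1, 0, 0, 1, 1], 6),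
   (bits [0, 0, 1, 0, 0, 1, 1, 1], 0),
   (bits [0, 0, 0, 1, 0, 1, 1, 1], 2)]

/-- The triple `S_3`. -/
def S3 : List (List DyckStep × ℕ) :=
  [(bits [0, 0, 0, 1, 1, 1], 0),
   (bits [0, 1, 0, 0, 1, 1], 1),
   (bits [0, 1, 0, 1, 0, 1], 5)]

/-- The quadruple `S_4`. -/
def S4 : List (List DyckStep × ℕ) :=
  [(bits [0, 0, 0, 1, 1, 1], 0),
   (bits [0, 0, 1, 0, 1, 1], 1),
   (bits [0, 1, 0, 0, 1, 1], 3),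
   (bits [0, 1, 0, 1, 0, 1], 5)]

/-- The complementary bit. -/
def flipStep : DyckStep → DyckStep
  | DyckStep.U => DyckStep.D
  | DyckStep.D => DyckStep.U

/-- The complement of the reversed string, with the position reversed too. -/
def reverseComplement (x : List DyckStep × ℕ) : List DyckStep × ℕ :=
  ((x.1.map flipStep).reverse, x.1.length - 1 - x.2)

/-- The collections `S_1(w)`, `S_2`, `S_3`, `S_4` and their reversed complements. -/
def IsPattern (S : List (List DyckStep × ℕ)) : Prop :=
  ∃ T, ((∃ w, T = S1 w) ∨ T = S2 ∨ T = S3 ∨ T = S4) ∧ (S = T ∨ S = T.map reverseComplement)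

/-- The hyperedges of `H_k`, each vertex with its position: the sets of all `u x v` with `x` in one
of the collections, where `u`, `v` are fixed and every `u x v` is a Dyck word of length `2k`. -/
def hyperedges (k : ℕ) : Set (Finset (MarkedWord k)) :=
  {h | ∃ S, IsPattern S ∧ ∃ u v : List DyckStep,
    (fun m : MarkedWord k => (m.1.1.toList, m.2)) '' (h : Set (MarkedWord k)) =
      {y | ∃ x ∈ S, y = (u ++ x.1 ++ v, x.2 + v.length)}}

/-- The vertices of a hyperedge. -/
def hVertices {k : ℕ} (h : Finset (MarkedWord k)) : Set (Word k) :=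
  {f | ∃ j, (f, j) ∈ h}

/-- Each hyperedge is replaced by the clique on its vertices. -/
def cliqueGraph {k : ℕ} (T : Set (Finset (MarkedWord k))) : SimpleGraph (Word k) where
  Adj f g := f ≠ g ∧ ∃ h ∈ T, f ∈ hVertices h ∧ g ∈ hVertices h
  symm := ⟨fun _ _ h => ⟨h.1.symm, h.2.imp fun _ h' => ⟨h'.1, h'.2.2, h'.2.1⟩⟩⟩
  loopless := ⟨fun _ h => h.1 rfl⟩

/-- `T` is (the set of hyperedges of) a spanning tree of `H_k`. -/
def IsSpanningTree {k : ℕ} (T : Set (Finset (MarkedWord k))) : Prop :=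
  T ⊆ hyperedges k ∧
  (∀ f : Word k, ∃ h ∈ T, f ∈ hVertices h) ∧
  (cliqueGraph T).Connected ∧
  ∀ (f : Word k) (c : (cliqueGraph T).Walk f f), c.IsCycle →
    ∃! h, h ∈ T ∧ ∀ g ∈ c.support, g ∈ hVertices h

/-- Two hyperedges share at most one vertex, and have different positions there. -/
def IsConflictFree {k : ℕ} (T : Set (Finset (MarkedWord k))) : Prop :=
  ∀ g ∈ T, ∀ h ∈ T, g ≠ h →
    (hVertices g ∩ hVertices h).Subsingleton ∧
    ∀ (f : Word k) (i j : ℕ), (f, i) ∈ g → (f, j) ∈ h → i ≠ j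

/-! ### Flipping cycles and lifts -/

/-- `e` is the flippable tuple of the marked word `m = (f, j)`: the pair of contiguous entries of
the list `L(f)` that uses the coordinate at position `j` from the right. -/
def IsFlippableTuple {k : ℕ} (m : MarkedWord k) (e : Sym2 (OddVertex k)) : Prop :=
  ∃ i, stepCoord m.1 i + m.2 = 2 * k ∧ IsListEdge m.1 i e

/-- `D` is (the edge set of) a flipping cycle of `h`: a cycle of `O_k` of twice the size of `h`,
which contains the flippable tuples of all members of `h`; these are pairwise disjoint edges, in
pairwise different lists and with pairwise different positions. -/
def IsFlippingCycle {k : ℕ} (h : Finset (MarkedWord k)) (D : Set (Sym2 (OddVertex k))) : Prop :=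
  Set.InjOn Prod.fst (h : Set (MarkedWord k)) ∧
  Set.InjOn Prod.snd (h : Set (MarkedWord k)) ∧
  IsCycleEdgeSet (oddGraph k) D ∧ D.ncard = 2 * h.card ∧
  ∃ e : MarkedWord k → Sym2 (OddVertex k),
    (∀ m ∈ h, IsFlippableTuple m (e m) ∧ e m ∈ D) ∧
    ∀ m ∈ h, ∀ m' ∈ h, m ≠ m' → ∀ a ∈ e m, a ∉ e m'

/-- `D'` is (the edge set of) a lift of the cycle `D` of `O_k`: a cycle of `M_k` that the covering
map sends bijectively onto `D`. -/
def IsLift {k : ℕ} (D : Set (Sym2 (OddVertex k))) (D' : Set (Sym2 (MiddleVertex k))) : Prop :=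
  IsCycleEdgeSet (middleGraph k) D' ∧ Set.BijOn (Sym2.map (covering k)) D' D

/-- The edge set obtained from the uniform 2-factor of `O_k` by flipping along the cycles `D h`. -/
def oddFlip {k : ℕ} (T : Set (Finset (MarkedWord k)))
    (D : Finset (MarkedWord k) → Set (Sym2 (OddVertex k))) : Set (Sym2 (OddVertex k)) :=
  symmDiff (oddFactor k) (⋃ h ∈ T, D h)

/-- The edge set obtained from the uniform 2-factor of `M_k` by flipping along the cycles `D' h`. -/
def middleFlip {k : ℕ} (T : Set (Finset (MarkedWord k)))
    (D' : Finset (MarkedWord k) → Set (Sym2 (MiddleVertex k))) : Set (Sym2 (MiddleVertex k)) :=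
  symmDiff (middleFactor k) (⋃ h ∈ T, D' h)

end MiddleLevels

/-! Both Hamilton cycles come from one gluing principle. Let `E` be a 2-regular edge set and `D` a
cycle that shares exactly one edge with `E` at each of its own vertices and at most one edge with
each component of `E`. Then `E ∆ D` is again 2-regular (`ncard_nbrs_symmDiff`), and it joins all
components that `D` meets, because a cycle stays connected when one edge is deleted
(`reachable_symmDiff`). Flip the hyperedges of `T` one by one. The tree condition keeps the lists of
the next hyperedge in different components (`not_reachable_of_notMem`), and conflict-freeness makes
the flipping cycles edge-disjoint (`disjoint_flippingCycles`). The induction `merge` is stated for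
any graph with a 2-factor whose cycles are indexed by Dyck words, so it serves `O_k` and `M_k`
alike.

For `O_k` the lists have to partition the vertices. Entry `i` of `L(f)` is `0f` with the letters of
rank above `2k - i` complemented, and everything is complemented once more if `i` is odd. The order
of the ranks is reversed at each level of nesting, so the weights alternate between two values
(`count_partialFlip`) and all entries are `k`-sets. First and last passage show that every `k`-set
occurs (`exists_partialFlip`), and the Catalan count turns this into a bijection
(`listVertex_bijective`). For `M_k`, the bipartite double cover of `O_k`, a list of odd length lifts
to a single cycle of twice the length (`isFibreFactor_middleFactor`), while a flipping cycle, having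
even length, lifts to a cycle of the same length (`exists_isLift`).

Flipping cycles exist because the strings on both sides of a letter at the moment it is reached, its
window, follow from the nesting alone (`IsWindow`). The letters of `u` and `v` around a Dyck factor
`x` are flipped in the same way for all `x` (`exists_frame`). Hence the tuples of a hyperedge agree
outside `x`, and closing them up to a cycle is a check on the windows (`Follows`), made once for
each of the two orientations. -/

namespace MiddleLevels

open DyckStep

/-! ### Rank strings of Dyck words -/

/-- Induction over the decomposition of a Dyck word into a block and a remainder. -/
theorem dyck_induction {P : DyckWord → Prop} (zero : P 0)
    (step : ∀ g h, P g → P h → P (g.nest + h)) (f : DyckWord) : P f := by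
  by_cases hf : f = 0
  · exact hf ▸ zero
  · have := step _ _ (dyck_induction zero step f.insidePart)
      (dyck_induction zero step f.outsidePart)
    rwa [DyckWord.nest_insidePart_add_outsidePart hf] at this
termination_by f.semilength
decreasing_by
  · exact DyckWord.semilength_insidePart_lt hf
  · exact DyckWord.semilength_outsidePart_lt hf

@[simp] theorem toList_zero : (0 : DyckWord).toList = [] := rfl

@[simp] theorem toList_add (f g : DyckWord) : (f + g).toList = f.toList ++ g.toList := rfl

@[simp] theorem toList_nest (f : DyckWord) : f.nest.toList = U :: (f.toList ++ [D]) := rfl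

@[simp] theorem rearrange_zero (l : List ℕ) : rearrange 0 l = [] := by
  rw [rearrange]; simp

theorem nest_add_ne_zero (g h : DyckWord) : g.nest + h ≠ 0 := by
  rw [← DyckWord.toList_ne_nil]; simp

/-- The working form of the recursion. The reversal of `l₁` is the reason why increasing and
decreasing order alternate with the nesting depth, so that `rank true` and `rank false` have to be
treated together throughout. -/
theorem rearrange_nest_add (g h : DyckWord) (a b : ℕ) (l₁ l₂ : List ℕ)
    (hl : l₁.length = g.toList.length) :
    rearrange (g.nest + h) (a :: (l₁ ++ b :: l₂)) =
      b :: (rearrange g l₁.reverse ++ a :: rearrange h l₂) := by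
  rw [rearrange]
  have hi : (g.nest + h).insidePart = g := by
    rw [DyckWord.insidePart_add DyckWord.nest_ne_zero, DyckWord.insidePart_nest]
  have ho : (g.nest + h).outsidePart = h := by
    rw [DyckWord.outsidePart_add DyckWord.nest_ne_zero, DyckWord.outsidePart_nest, zero_add]
  have h1 : (a :: (l₁ ++ b :: l₂)).take (g.toList.length + 2) = a :: (l₁ ++ [b]) := by
    simp [← hl, List.take_append]
  have h2 : (a :: (l₁ ++ b :: l₂)).drop (g.toList.length + 2) = l₂ := by
    simp [← hl, List.drop_append]
  have h3 : (a :: (l₁ ++ [b])).reverse = b :: (l₁.reverse ++ [a]) := by simp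
  rw [dif_neg (nest_add_ne_zero g h)]
  simp only [hi, ho, h1, h2, h3]
  simp [← hl, List.take_append, List.drop_append]

theorem exists_block_split {n : ℕ} {l : List ℕ} (h : n + 2 ≤ l.length) :
    ∃ a l₁ b l₂, l = a :: (l₁ ++ b :: l₂) ∧ l₁.length = n := by
  match l with
  | [] => simp at h
  | a :: t =>
    have h' : n < t.length := by simp at h; omega
    refine ⟨a, t.take n, t[n], t.drop (n + 1), ?_, by simp; omega⟩
    rw [List.getElem_cons_drop, List.take_append_drop]

theorem rearrange_add (f g : DyckWord) (l₁ l₂ : List ℕ) (h : l₁.length = f.toList.length) :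
    rearrange (f + g) (l₁ ++ l₂) = rearrange f l₁ ++ rearrange g l₂ := by
  induction f using dyck_induction generalizing l₁ l₂ with
  | zero => simp_all
  | step a b _ ihb =>
    obtain ⟨x, m, y, m', rfl, hm⟩ := exists_block_split (n := a.toList.length) (l := l₁)
      (by rw [h]; simp)
    have hm' : m'.length = b.toList.length := by simp at h; omega
    have := rearrange_nest_add a (b + g) x y m (m' ++ l₂) hm
    simp only [List.cons_append, List.append_assoc, add_assoc] at *
    rw [this, rearrange_nest_add a b x y m m' hm, ihb _ _ hm']
    simp

theorem rearrange_perm (f : DyckWord) (l : List ℕ) (h : l.length = f.toList.length) :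
    (rearrange f l).Perm l := by
  induction f using dyck_induction generalizing l with
  | zero => simp_all
  | step a b iha ihb =>
    obtain ⟨x, m, y, m', rfl, hm⟩ := exists_block_split (n := a.toList.length) (l := l)
      (by rw [h]; simp)
    have hm' : m'.length = b.toList.length := by simp at h; omega
    rw [rearrange_nest_add a b x y m m' hm]
    have h1 := (iha m.reverse (by simpa using hm)).trans m.reverse_perm
    have h2 := ihb m' hm'
    calc y :: (rearrange a m.reverse ++ x :: rearrange b m')
        _ |>.Perm (y :: (m ++ x :: m')) := (h1.append (h2.cons x)).cons y
        _ |>.Perm (y :: x :: (m ++ m')) := List.perm_middle.cons y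
        _ |>.Perm (x :: y :: (m ++ m')) := List.Perm.swap ..
        _ |>.Perm (x :: (m ++ y :: m')) := List.perm_middle.symm.cons x

/-- The numbers `s, …, s + n - 1` in increasing (`true`) or decreasing (`false`) order. -/
def interval (b : Bool) (s n : ℕ) : List ℕ :=
  if b then List.range' s n else (List.range' s n).reverse

/-- The string of numbers above a Dyck word that is obtained from an interval of numbers. -/
def rank (b : Bool) (s : ℕ) (f : DyckWord) : List ℕ :=
  rearrange f (interval b s f.toList.length)

@[simp] theorem length_interval (b : Bool) (s n : ℕ) : (interval b s n).length = n := by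
  cases b <;> simp [interval]

theorem mem_interval {b : Bool} {s n x : ℕ} : x ∈ interval b s n ↔ s ≤ x ∧ x < s + n := by
  cases b <;> simp [interval, List.mem_range'_1]

theorem nodup_interval (b : Bool) (s n : ℕ) : (interval b s n).Nodup := by
  cases b <;> simp [interval, List.nodup_range']

theorem rank_perm (b : Bool) (s : ℕ) (f : DyckWord) :
    (rank b s f).Perm (interval b s f.toList.length) :=
  rearrange_perm f _ (length_interval ..)

@[simp] theorem length_rank (b : Bool) (s : ℕ) (f : DyckWord) :
    (rank b s f).length = f.toList.length := by
  rw [(rank_perm b s f).length_eq, length_interval]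

theorem mem_rank {b : Bool} {s x : ℕ} {f : DyckWord} :
    x ∈ rank b s f ↔ s ≤ x ∧ x < s + f.toList.length := by
  rw [(rank_perm b s f).mem_iff, mem_interval]

theorem nodup_rank (b : Bool) (s : ℕ) (f : DyckWord) : (rank b s f).Nodup :=
  (rank_perm b s f).nodup_iff.2 (nodup_interval ..)

@[simp] theorem rank_zero (b : Bool) (s : ℕ) : rank b s 0 = [] := rearrange_zero _

theorem rank_true_add (s : ℕ) (f g : DyckWord) :
    rank true s (f + g) = rank true s f ++ rank true (s + f.toList.length) g := by
  unfold rank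
  rw [← rearrange_add f g _ _ (length_interval ..)]
  simp [interval, List.range'_append_1]

theorem rank_false_add (s : ℕ) (f g : DyckWord) :
    rank false s (f + g) = rank false (s + g.toList.length) f ++ rank false s g := by
  unfold rank
  rw [← rearrange_add f g _ _ (length_interval ..)]
  simp only [interval, Bool.false_eq_true, if_false, ← List.reverse_append,
    List.range'_append_1, toList_add, List.length_append]
  rw [add_comm g.toList.length]

theorem range'_succ_succ (s n : ℕ) :
    List.range' s (n + 2) = s :: (List.range' (s + 1) n ++ [s + n + 1]) := by
  rw [List.range'_succ, List.range'_1_concat, show s + 1 + n = s + n + 1 by omega]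

theorem rank_true_nest (s : ℕ) (g : DyckWord) :
    rank true s g.nest = (s + g.toList.length + 1) :: (rank false (s + 1) g ++ [s]) := by
  have := rearrange_nest_add g 0 s (s + g.toList.length + 1)
    (List.range' (s + 1) g.toList.length) [] (by simp)
  simp only [add_zero, rearrange_zero] at this
  simp only [rank, interval, if_true, toList_nest, List.length_cons, List.length_append,
    List.length_nil, zero_add, Bool.false_eq_true, if_false]
  rw [← this, ← range'_succ_succ]

theorem rank_false_nest (s : ℕ) (g : DyckWord) :
    rank false s g.nest = s :: (rank true (s + 1) g ++ [s + g.toList.length + 1]) := by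
  have := rearrange_nest_add g 0 (s + g.toList.length + 1) s
    (List.range' (s + 1) g.toList.length).reverse [] (by simp)
  simp only [add_zero, rearrange_zero, List.reverse_reverse] at this
  simp only [rank, interval, if_true, toList_nest, List.length_cons, List.length_append,
    List.length_nil, zero_add, Bool.false_eq_true, if_false]
  rw [← this, range'_succ_succ]
  simp

/-! ### Partial flips -/

@[simp] theorem flipStep_flipStep (a : DyckStep) : flipStep (flipStep a) = a := by cases a <;> rfl

@[simp] theorem flipStep_U : flipStep U = D := rfl

@[simp] theorem flipStep_D : flipStep D = U := rfl

theorem flipStep_injective : Function.Injective flipStep :=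
  Function.LeftInverse.injective flipStep_flipStep

/-- Complement the letters of a string whose number exceeds `t`. -/
def flipAbove (t : ℕ) (f : List DyckStep) (p : List ℕ) : List DyckStep :=
  List.zipWith (fun a n => if t < n then flipStep a else a) f p

@[simp] theorem flipAbove_nil (t : ℕ) : flipAbove t [] [] = [] := rfl

@[simp] theorem flipAbove_cons (t : ℕ) (a : DyckStep) (f : List DyckStep) (n : ℕ) (p : List ℕ) :
    flipAbove t (a :: f) (n :: p) = (if t < n then flipStep a else a) :: flipAbove t f p := rfl

theorem flipAbove_append {t : ℕ} {f g : List DyckStep} {p q : List ℕ} (h : f.length = p.length) :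
    flipAbove t (f ++ g) (p ++ q) = flipAbove t f p ++ flipAbove t g q :=
  List.zipWith_append h

theorem length_flipAbove {t : ℕ} {f : List DyckStep} {p : List ℕ} (h : f.length = p.length) :
    (flipAbove t f p).length = f.length := by
  simp [flipAbove, h]

theorem flipAbove_of_lt {t : ℕ} {f : List DyckStep} {p : List ℕ} (h : f.length = p.length)
    (ht : ∀ n ∈ p, t < n) : flipAbove t f p = f.map flipStep := by
  induction f generalizing p with
  | nil => simp [flipAbove]
  | cons a f ih =>
    match p with
    | n :: p =>
      simp only [List.length_cons, add_left_inj, List.mem_cons, forall_eq_or_imp] at h ht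
      rw [flipAbove_cons, if_pos ht.1, ih h ht.2, List.map_cons]

theorem flipAbove_of_le {t : ℕ} {f : List DyckStep} {p : List ℕ} (h : f.length = p.length)
    (ht : ∀ n ∈ p, n ≤ t) : flipAbove t f p = f := by
  induction f generalizing p with
  | nil => simp [flipAbove]
  | cons a f ih =>
    match p with
    | n :: p =>
      simp only [List.length_cons, add_left_inj, List.mem_cons, forall_eq_or_imp] at h ht
      rw [flipAbove_cons, if_neg (by omega), ih h ht.2]

/-- Complement the letters of a Dyck word whose rank exceeds `t`. -/
def partialFlip (b : Bool) (s : ℕ) (f : DyckWord) (t : ℕ) : List DyckStep :=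
  flipAbove t f.toList (rank b s f)

@[simp] theorem partialFlip_zero (b : Bool) (s t : ℕ) : partialFlip b s 0 t = [] := by
  simp [partialFlip]

theorem partialFlip_of_lt {b : Bool} {s : ℕ} {f : DyckWord} {t : ℕ} (h : t < s) :
    partialFlip b s f t = f.toList.map flipStep :=
  flipAbove_of_lt (by simp) fun n hn => by rw [mem_rank] at hn; omega

theorem partialFlip_of_le {b : Bool} {s : ℕ} {f : DyckWord} {t : ℕ}
    (h : s + f.toList.length ≤ t + 1) : partialFlip b s f t = f.toList :=
  flipAbove_of_le (by simp) fun n hn => by rw [mem_rank] at hn; omega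

theorem partialFlip_true_add (s : ℕ) (f g : DyckWord) (t : ℕ) :
    partialFlip true s (f + g) t =
      partialFlip true s f t ++ partialFlip true (s + f.toList.length) g t := by
  simp only [partialFlip, rank_true_add, toList_add]
  exact flipAbove_append (by simp)

theorem partialFlip_false_add (s : ℕ) (f g : DyckWord) (t : ℕ) :
    partialFlip false s (f + g) t =
      partialFlip false (s + g.toList.length) f t ++ partialFlip false s g t := by
  simp only [partialFlip, rank_false_add, toList_add]
  exact flipAbove_append (by simp)

theorem partialFlip_true_nest (s : ℕ) (g : DyckWord) (t : ℕ) :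
    partialFlip true s g.nest t = (if t < s + g.toList.length + 1 then D else U) ::
      (partialFlip false (s + 1) g t ++ [if t < s then U else D]) := by
  simp only [partialFlip, rank_true_nest, toList_nest, flipAbove_cons]
  rw [flipAbove_append (by simp)]
  simp

theorem partialFlip_false_nest (s : ℕ) (g : DyckWord) (t : ℕ) :
    partialFlip false s g.nest t = (if t < s then D else U) ::
      (partialFlip true (s + 1) g t ++ [if t < s + g.toList.length + 1 then U else D]) := by
  simp only [partialFlip, rank_false_nest, toList_nest, flipAbove_cons]
  rw [flipAbove_append (by simp)]
  simp

@[simp] theorem length_partialFlip (b : Bool) (s : ℕ) (f : DyckWord) (t : ℕ) :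
    (partialFlip b s f t).length = f.toList.length :=
  length_flipAbove (by simp)

theorem count_map_flipStep (l : List DyckStep) (a : DyckStep) :
    (l.map flipStep).count a = l.count (flipStep a) := by
  conv_lhs => rw [← flipStep_flipStep a]
  exact List.count_map_of_injective l flipStep flipStep_injective _

theorem count_U_add_count_D (l : List DyckStep) : l.count U + l.count D = l.length := by
  induction l with
  | nil => rfl
  | cons a l ih => cases a <;> simp <;> omega

theorem length_eq_two_mul (f : DyckWord) : f.toList.length = 2 * f.semilength :=
  f.two_mul_semilength_eq_length.symm

/-- The weights of the partial flips alternate. -/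
theorem count_partialFlip (f : DyckWord) (s t i : ℕ) (h : i + t + 1 = s + f.toList.length)
    (hi : i ≤ f.toList.length) :
    (partialFlip true s f t).count D = f.semilength + i % 2 ∧
      (partialFlip false s f t).count U = f.semilength + i % 2 := by
  induction f using dyck_induction generalizing s t i with
  | zero => simp at *; omega
  | step g h' ihg ihh =>
    have e1 := length_eq_two_mul g
    have e2 := length_eq_two_mul h'
    have c1 := g.semilength_eq_count_D
    have c2 := h'.semilength_eq_count_D
    have c3 : g.semilength = g.toList.count U := rfl
    have c4 : h'.semilength = h'.toList.count U := rfl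
    simp only [toList_add, toList_nest, List.length_append, List.length_cons, List.length_nil] at h hi
    simp only [partialFlip_true_add, partialFlip_false_add, partialFlip_true_nest,
      partialFlip_false_nest, toList_nest, List.count_append, List.count_cons, List.count_nil,
      List.length_append, List.length_cons, List.length_nil, DyckWord.semilength_add,
      DyckWord.semilength_nest]
    constructor
    -- In the increasing orientation the ranks of `h'` are the largest and are flipped first. Then
    -- come the opening letter of the block, the interior in the opposite orientation, and the
    -- closing letter.
    · by_cases hh : i ≤ h'.toList.length
      · have h1 := (ihh (s + (g.toList.length + 1 + 1)) t i (by omega) hh).1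
        have n1 : ¬ t < s + g.toList.length + 1 := by omega
        have n2 : ¬ t < s := by omega
        simp only [zero_add] at *
        rw [h1, partialFlip_of_le (f := g) (by omega)]
        simp [n1, n2]; omega
      · rw [partialFlip_of_lt (f := h') (by omega), count_map_flipStep, flipStep_D]
        have n1 : t < s + g.toList.length + 1 := by omega
        by_cases hs : t < s
        · rw [partialFlip_of_lt (f := g) (by omega), count_map_flipStep, flipStep_D]
          simp [n1, hs]; omega
        · have h1 := (ihg (s + 1) t (i - h'.toList.length - 1) (by omega) (by omega)).2
          have h2 := count_U_add_count_D (partialFlip false (s + 1) g t)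
          rw [length_partialFlip] at h2
          simp [n1, hs]; omega
    -- In the decreasing orientation the block goes before `h'`, starting with its closing letter;
    -- this letter accounts for the shift to `i - 1` in the interior.
    · by_cases hh : i ≤ g.toList.length + 1
      · rw [partialFlip_of_le (f := h') (by omega)]
        have n1 : ¬ t < s + h'.toList.length := by omega
        by_cases h0 : i = 0
        · have n2 : ¬ t < s + h'.toList.length + g.toList.length + 1 := by omega
          rw [partialFlip_of_le (f := g) (by omega)]
          simp [n1, n2]; omega
        · have n2 : t < s + h'.toList.length + g.toList.length + 1 := by omega
          have h1 := (ihg (s + h'.toList.length + 1) t (i - 1) (by omega) (by omega)).1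
          have h2 := count_U_add_count_D (partialFlip true (s + h'.toList.length + 1) g t)
          rw [length_partialFlip] at h2
          simp [n1, n2]; omega
      · have h1 := (ihh s t (i - (g.toList.length + 2)) (by omega) (by omega)).2
        have n1 : t < s + h'.toList.length := by omega
        have n2 : t < s + h'.toList.length + g.toList.length + 1 := by omega
        rw [h1, partialFlip_of_lt (f := g) (by omega), count_map_flipStep, flipStep_U]
        simp [n1, n2]; omega

end MiddleLevels

namespace MiddleLevels

open DyckStep

/-! ### Every string is a partial flip of a Dyck word -/

theorem exists_dyckWord {l : List DyckStep} (h₁ : l.count U = l.count D)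
    (h₂ : ∀ i, (l.take i).count D ≤ (l.take i).count U) : ∃ A : DyckWord, A.toList = l :=
  ⟨⟨l, h₁, h₂⟩, rfl⟩

/-- The reversed complement of a Dyck word. -/
theorem exists_dyckWord_reverse (A : DyckWord) :
    ∃ N : DyckWord, N.toList.map flipStep = A.toList.reverse := by
  have hAc := A.count_U_eq_count_D
  obtain ⟨N, hN⟩ := exists_dyckWord (l := A.toList.reverse.map flipStep)
    (by simp [count_map_flipStep, hAc])
    (fun i => by
      rw [← List.map_take, count_map_flipStep, count_map_flipStep, List.take_reverse,
        List.count_reverse, List.count_reverse]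
      have h1 := A.count_D_le_count_U (A.toList.length - i)
      rw [← List.take_append_drop (A.toList.length - i) A.toList, List.count_append,
        List.count_append] at hAc
      simp only [flipStep_U, flipStep_D]
      omega)
  refine ⟨N, ?_⟩
  rw [hN, List.map_map]
  simp [Function.comp_def]

/-- The shortest prefix with an excess of `D`s ends in `D`, and what precedes that letter is
balanced with no bad prefix. -/
theorem first_passage (l : List DyckStep) :
    (∀ i, (l.take i).count D ≤ (l.take i).count U) ∨
      ∃ (A : DyckWord) (z : List DyckStep), l = A.toList ++ D :: z := by
  by_cases h : ∀ i, (l.take i).count D ≤ (l.take i).count U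
  · exact Or.inl h
  · right
    push Not at h
    classical
    obtain ⟨n, hn, hmin⟩ : ∃ n, (l.take n).count U < (l.take n).count D ∧
        ∀ m < n, (l.take m).count D ≤ (l.take m).count U :=
      ⟨Nat.find h, Nat.find_spec h, fun m hm => not_lt.1 (Nat.find_min h hm)⟩
    match n with
    | 0 => simp at hn
    | n + 1 =>
      have hle := hmin n (by omega)
      have hlt : n < l.length := by
        by_contra hge
        rw [List.take_of_length_le (by omega)] at hn hle
        omega
      have hspl : l = l.take n ++ l[n] :: l.drop (n + 1) := by
        rw [List.getElem_cons_drop, List.take_append_drop]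
      rw [List.take_succ_eq_append_getElem hlt, List.count_append, List.count_append] at hn
      have hD : l[n] = D := by
        rcases DyckStep.dichotomy l[n] with h' | h'
        · rw [h'] at hn; simp at hn; omega
        · exact h'
      rw [hD] at hn hspl
      simp at hn
      obtain ⟨A, hA⟩ := exists_dyckWord (l := l.take n) (by omega) (fun i => by
        rw [List.take_take]; exact hmin _ (by omega))
      exact ⟨A, _, by rw [hA]; exact hspl⟩

/-- The mirror image of `first_passage`, applied to the reversed string; reversal turns the Dyck
factor into the complement of a Dyck word. -/
theorem last_passage (l : List DyckStep) :
    (∀ i, (l.drop i).count D ≤ (l.drop i).count U) ∨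
      ∃ (z : List DyckStep) (N : DyckWord), l = z ++ D :: N.toList.map flipStep := by
  rcases first_passage l.reverse with h | ⟨A, z, h⟩
  · left
    intro i
    have := h (l.length - i)
    rw [List.take_reverse, List.count_reverse, List.count_reverse] at this
    by_cases hi : i ≤ l.length
    · rwa [show l.length - (l.length - i) = i by omega] at this
    · rw [List.drop_of_length_le (by omega)]; simp
  · right
    obtain ⟨N, hN⟩ := exists_dyckWord_reverse A
    refine ⟨z.reverse, N, ?_⟩
    rw [hN, ← List.reverse_reverse l, h]
    simp

/-- As a lattice path, `y` ends at or below its starting height. Either it is nonnegative up to a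
return to height zero and nonpositive afterwards, or the first step below zero and the last `D`
found from the right enclose a middle part `z`. -/
theorem passage_decomposition {y : List DyckStep} {n δ : ℕ} (hy : y.length = 2 * n)
    (hD : y.count D = n + δ) :
    (∃ A N : DyckWord, y = A.toList ++ N.toList.map flipStep) ∨
      ∃ (A : DyckWord) (z : List DyckStep) (N : DyckWord),
        y = A.toList ++ D :: (z ++ D :: N.toList.map flipStep) := by
  have hUD := count_U_add_count_D y
  rcases first_passage y with h | ⟨A, z, rfl⟩
  · have := h y.length
    rw [List.take_length] at this
    obtain ⟨A, hA⟩ := exists_dyckWord (by omega) h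
    exact Or.inl ⟨A, 0, by simp [hA]⟩
  · have hA := A.count_U_eq_count_D
    rcases last_passage (D :: z) with h | ⟨z', N, h⟩
    -- The whole tail `D :: z` has at least as many `D`s as `U`s by `hD`, and at most as many by `h
    -- 0`. So it is balanced, and its suffix condition becomes the prefix condition of its
    -- complement.
    · left
      have h0 := h 0
      rw [List.drop_zero] at h0
      simp only [List.count_append] at hUD hD
      obtain ⟨N, hN⟩ := exists_dyckWord (l := (D :: z).map flipStep)
        (by simp only [count_map_flipStep, flipStep_U, flipStep_D]; simp at *; omega)
        (fun i => by
          rw [← List.map_take, count_map_flipStep, count_map_flipStep, flipStep_U, flipStep_D]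
          have hi := h i
          have e : ∀ a, (D :: z).count a =
              ((D :: z).take i).count a + ((D :: z).drop i).count a := fun a => by
            rw [← List.count_append, List.take_append_drop]
          have e1 := e U
          have e2 := e D
          simp only [List.length_append] at *
          omega)
      refine ⟨A, N, ?_⟩
      rw [hN, List.map_map]
      simp [Function.comp_def]
    · match z' with
      -- The two passages cannot use the same `D`, since `y` has even length.
      | [] =>
        exfalso
        have hN := N.count_U_eq_count_D
        have hN' := count_U_add_count_D N.toList
        rw [h] at hUD hD hy
        simp [count_map_flipStep] at hUD hD hy
        omega
      | a :: z'' =>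
        right
        rw [List.cons_append, List.cons_eq_cons] at h
        exact ⟨A, z'', N, by rw [h.2]⟩

/-- A partial flip stopped inside a block looks like `A D z D N̄` in the increasing orientation: the
blocks to the left are untouched, those to the right are fully flipped, and `z` is a partial flip of
the interior in the decreasing orientation. Reading this backwards gives the induction, which has to
treat both orientations at once. -/
theorem exists_partialFlip (n : ℕ) (y : List DyckStep) (s δ : ℕ) (hs : 1 ≤ s)
    (hy : y.length = 2 * n) (hδ : δ ≤ 1) :
    (y.count D = n + δ → ∃ (f : DyckWord) (t : ℕ), f.semilength = n ∧ s ≤ t + 1 ∧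
      t + 1 ≤ s + 2 * n ∧ partialFlip true s f t = y) ∧
    (y.count U = n + δ → ∃ (f : DyckWord) (t : ℕ), f.semilength = n ∧ s ≤ t + 1 ∧
      t + 1 ≤ s + 2 * n ∧ partialFlip false s f t = y) := by
  induction n using Nat.strong_induction_on generalizing y s δ with
  | _ n ih =>
  constructor
  · intro hD
    rcases passage_decomposition hy hD with ⟨A, N, rfl⟩ | ⟨A, z, N, rfl⟩
    · have eA := length_eq_two_mul A
      have eN := length_eq_two_mul N
      simp only [List.length_append, List.length_map] at hy
      -- This threshold separates the ranks of `A` from the larger ranks of `N`. For empty `A` it is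
      -- `s - 1`, an honest subtraction because of `hs`.
      refine ⟨A + N, s + A.toList.length - 1, by simp; omega, by omega, by omega, ?_⟩
      rw [partialFlip_true_add, partialFlip_of_le (by omega), partialFlip_of_lt (by omega)]
    · have eA := length_eq_two_mul A
      have eN := length_eq_two_mul N
      have cA := A.semilength_eq_count_D
      have cN : N.semilength = N.toList.count U := rfl
      have ez := count_U_add_count_D z
      simp only [List.length_append, List.length_map, List.length_cons, List.count_append,
        List.count_cons, count_map_flipStep, flipStep_D, beq_self_eq_true, if_true] at hy hD
      -- Removing the two enclosing `D`s leaves an excess of `1 - δ`, now in the letter `U`, as the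
      -- decreasing orientation requires.
      obtain ⟨g, t, hg, ht₁, ht₂, hgt⟩ := (ih (n - 1 - A.semilength - N.semilength) (by omega) z
        (s + A.toList.length + 1) (1 - δ) (by omega) (by omega) (by omega)).2 (by omega)
      have eg := length_eq_two_mul g
      refine ⟨A + (g.nest + N), t, by simp; omega, by omega, by omega, ?_⟩
      rw [partialFlip_true_add, partialFlip_of_le (by omega), partialFlip_true_add,
        partialFlip_true_nest, hgt, if_pos (by omega), if_neg (by omega),
        partialFlip_of_lt (f := N) (by simp; omega)]
      simp
  · intro hU
    -- In the decreasing orientation the left part is flipped first, so the complement of `y` is the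
    -- string to decompose.
    have hD : (y.map flipStep).count D = n + δ := by rw [count_map_flipStep, flipStep_D, hU]
    rcases passage_decomposition (by simpa using hy) hD with ⟨A, N, h⟩ | ⟨A, z, N, h⟩
    · have eA := length_eq_two_mul A
      have eN := length_eq_two_mul N
      have e := congrArg List.length h
      simp only [List.length_append, List.length_map] at e
      have h' := congrArg (List.map flipStep) h
      simp only [List.map_append, List.map_map, Function.comp_def, flipStep_flipStep,
        List.map_id'] at h'
      refine ⟨A + N, s + N.toList.length - 1, by simp; omega, by omega, by omega, ?_⟩
      rw [partialFlip_false_add, partialFlip_of_lt (by omega), partialFlip_of_le (by omega), h']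
    · have eA := length_eq_two_mul A
      have eN := length_eq_two_mul N
      have cA := A.semilength_eq_count_D
      have cN : N.semilength = N.toList.count U := rfl
      have ez := count_U_add_count_D z
      have e := congrArg List.length h
      have h' := congrArg (List.map flipStep) h
      simp only [List.map_append, List.map_map, Function.comp_def, flipStep_flipStep,
        List.map_id', List.map_cons, flipStep_D] at h'
      rw [h] at hD
      simp only [List.length_append, List.length_map, List.length_cons, List.count_append,
        List.count_cons, count_map_flipStep, flipStep_D, beq_self_eq_true, if_true] at e hD
      obtain ⟨g, t, hg, ht₁, ht₂, hgt⟩ := (ih (n - 1 - A.semilength - N.semilength) (by omega)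
        (z.map flipStep) (s + N.toList.length + 1) (1 - δ) (by omega) (by simp; omega)
        (by omega)).1 (by rw [count_map_flipStep, flipStep_D]; omega)
      have eg := length_eq_two_mul g
      refine ⟨A + (g.nest + N), t, by simp; omega, by omega, by omega, ?_⟩
      rw [partialFlip_false_add, partialFlip_of_lt (by simp; omega), partialFlip_false_add,
        partialFlip_false_nest, hgt, if_neg (by omega), if_pos (by omega),
        partialFlip_of_le (f := N) (by omega), h']
      simp

/-! ### The entries of the lists -/

/-- The set of positions of the letter `1` in a string. -/
def onesSet (n : ℕ) (l : List DyckStep) : Finset (Fin n) :=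
  Finset.univ.filter fun c => l[c.val]? = some D

theorem mem_onesSet {n : ℕ} {l : List DyckStep} {c : Fin n} :
    c ∈ onesSet n l ↔ l[c.val]? = some D := by simp [onesSet]

theorem card_onesSet {n : ℕ} {l : List DyckStep} (h : l.length = n) :
    (onesSet n l).card = l.count D := by
  induction n generalizing l with
  | zero => rw [List.length_eq_zero_iff] at h; subst h; rfl
  | succ n ih =>
    match l with
    | a :: l =>
      have := ih (l := l) (by simpa using h)
      unfold onesSet at *
      rw [Fin.card_filter_univ_succ]
      cases a <;> simp [this]

theorem exists_onesSet {n : ℕ} (S : Finset (Fin n)) :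
    ∃ l : List DyckStep, l.length = n ∧ onesSet n l = S := by
  classical
  refine ⟨List.ofFn fun c => if c ∈ S then D else U, by simp, ?_⟩
  ext c
  simp [mem_onesSet]

theorem onesSet_complement {n : ℕ} (X Y : List DyckStep) (h : X.length + 1 + Y.length = n) :
    onesSet n (X.map flipStep ++ U :: Y.map flipStep) =
      Finset.univ.filter fun c => c ∉ onesSet n (X ++ U :: Y) ∧ c.val ≠ X.length := by
  ext c
  have hc := c.2
  simp only [mem_onesSet, Finset.mem_filter, Finset.mem_univ, true_and]
  rcases lt_trichotomy c.val X.length with h1 | h1 | h1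
  · rw [List.getElem?_append_left (by simpa using h1), List.getElem?_append_left h1,
      List.getElem?_map, List.getElem?_eq_getElem h1]
    cases X[c.val] <;> simp [h1.ne]
  · simp [h1]
  · obtain ⟨d, hd⟩ : ∃ d, c.val = X.length + (d + 1) := ⟨c.val - X.length - 1, by omega⟩
    have hd' : d < Y.length := by omega
    rw [List.getElem?_append_right (by simp; omega), List.getElem?_append_right (by omega), hd]
    simp only [List.length_map, Nat.add_sub_cancel_left, List.getElem?_cons_succ,
      List.getElem?_map, List.getElem?_eq_getElem hd']
    cases Y[d] <;> simp

/-- The complement of a string if `i` is odd, and the string itself otherwise. -/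
def flipPow (i : ℕ) (l : List DyckStep) : List DyckStep :=
  if i % 2 = 0 then l else l.map flipStep

theorem flipPow_succ (i : ℕ) (l : List DyckStep) :
    flipPow (i + 1) l = (flipPow i l).map flipStep := by
  unfold flipPow
  rcases Nat.mod_two_eq_zero_or_one i with h | h
  · simp [h, show (i + 1) % 2 = 1 by omega]
  · simp [h, show (i + 1) % 2 = 0 by omega, Function.comp_def]

@[simp] theorem length_flipPow (i : ℕ) (l : List DyckStep) : (flipPow i l).length = l.length := by
  unfold flipPow; split_ifs <;> simp

theorem flipPow_append (i : ℕ) (l l' : List DyckStep) :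
    flipPow i (l ++ l') = flipPow i l ++ flipPow i l' := by
  unfold flipPow; split_ifs <;> simp

variable {k : ℕ}

theorem length_word (f : Word k) : f.1.toList.length = 2 * k := by
  rw [length_eq_two_mul, f.2]

theorem permString_eq (f : Word k) : permString f = rank true 1 f.1 := by
  simp [permString, rank, interval, length_word]

/-- The string whose ones form entry `i` of the list of `f`. -/
def listWord (f : Word k) (i : ℕ) : List DyckStep :=
  flipPow i (U :: partialFlip true 1 f.1 (2 * k - i))

@[simp] theorem length_listWord (f : Word k) (i : ℕ) : (listWord f i).length = 2 * k + 1 := by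
  simp [listWord, length_word]

theorem count_listWord (f : Word k) {i : ℕ} (hi : i ≤ 2 * k) : (listWord f i).count D = k := by
  have h := (count_partialFlip f.1 1 (2 * k - i) i (by rw [length_word]; omega)
    (by rw [length_word]; omega)).1
  have h' := count_U_add_count_D (partialFlip true 1 f.1 (2 * k - i))
  rw [length_partialFlip, length_word] at h'
  rw [f.2] at h
  unfold listWord flipPow
  split_ifs with hi
  · simp [h, hi]
  · rw [count_map_flipStep, flipStep_D]
    simp; omega

theorem flipAbove_congr {t t' : ℕ} {f : List DyckStep} {p : List ℕ}
    (h : ∀ n ∈ p, t < n ↔ t' < n) : flipAbove t f p = flipAbove t' f p := by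
  induction f generalizing p with
  | nil => simp [flipAbove]
  | cons a f ih =>
    match p with
    | [] => rfl
    | n :: p =>
      simp only [List.mem_cons, forall_eq_or_imp] at h
      rw [flipAbove_cons, flipAbove_cons, ih h.2]
      simp only [h.1]

/-- The two entries of a list at the step where the number `t` is reached. -/
theorem listWord_split (f : Word k) {t : ℕ} {f₁ f₂ : List DyckStep} {a : DyckStep}
    {p₁ p₂ : List ℕ} (hf : f.1.toList = f₁ ++ a :: f₂) (hp : rank true 1 f.1 = p₁ ++ t :: p₂)
    (hl : f₁.length = p₁.length) :
    t ≤ 2 * k ∧ 1 ≤ t ∧ stepCoord f (2 * k - t) = f₁.length + 1 ∧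
    listWord f (2 * k - t) = flipPow (2 * k - t) (U :: flipAbove t f₁ p₁) ++
      U :: flipPow (2 * k - t) (flipAbove t f₂ p₂) ∧
    listWord f (2 * k - t + 1) = flipPow (2 * k - t + 1) (U :: flipAbove t f₁ p₁) ++
      U :: flipPow (2 * k - t + 1) (flipAbove t f₂ p₂) := by
  have ht : t ∈ rank true 1 f.1 := by simp [hp]
  rw [mem_rank, length_word] at ht
  have hnd := nodup_rank true 1 f.1
  rw [hp] at hnd
  have ht₁ : t ∉ p₁ := fun h => by
    rw [List.nodup_append] at hnd
    exact hnd.2.2 t h t (by simp) rfl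
  have ht₂ : t ∉ p₂ := (List.nodup_cons.1 (List.nodup_append.1 hnd).2.1).1
  have hsub : 2 * k - (2 * k - t) = t := by omega
  have e₁ : listWord f (2 * k - t) = flipPow (2 * k - t) (U :: flipAbove t f₁ p₁) ++
      flipPow (2 * k - t) [a] ++ flipPow (2 * k - t) (flipAbove t f₂ p₂) := by
    rw [← flipPow_append, ← flipPow_append, listWord, partialFlip, hsub, hf, hp,
      flipAbove_append hl]
    simp
  have e₂ : listWord f (2 * k - t + 1) = flipPow (2 * k - t + 1) (U :: flipAbove t f₁ p₁) ++
      flipPow (2 * k - t + 1) [flipStep a] ++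
      flipPow (2 * k - t + 1) (flipAbove t f₂ p₂) := by
    rw [← flipPow_append, ← flipPow_append, listWord, partialFlip, Nat.sub_add_eq, hsub, hf, hp,
      flipAbove_append hl]
    -- The next entry has threshold `t - 1`. It differs from `t` only at the letter of rank `t`, as
    -- the ranks are distinct.
    rw [flipAbove_congr (t := t - 1) (t' := t) (p := p₁), flipAbove_cons, if_pos (by omega),
      flipAbove_congr (t := t - 1) (t' := t) (p := p₂)]
    · simp
    · intro n hn
      have : n ≠ t := fun h => ht₂ (h ▸ hn)
      omega
    · intro n hn
      have : n ≠ t := fun h => ht₁ (h ▸ hn)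
      omega
  have e₃ : flipPow (2 * k - t + 1) [flipStep a] = flipPow (2 * k - t) [a] := by
    rw [flipPow_succ]; unfold flipPow; split_ifs <;> simp
  -- The two entries share this letter and are complementary at the other `2k` positions. Both have
  -- weight `k`, so the shared letter contributes nothing.
  have e₄ : flipPow (2 * k - t) [a] = [U] := by
    have c₁ := count_listWord f (i := 2 * k - t) (by omega)
    have c₂ := count_listWord f (i := 2 * k - t + 1) (by omega)
    have l₁ := length_listWord f (2 * k - t)
    rw [e₁] at c₁ l₁
    rw [e₂, e₃, flipPow_succ, flipPow_succ] at c₂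
    have := count_U_add_count_D (flipPow (2 * k - t) (U :: flipAbove t f₁ p₁))
    have := count_U_add_count_D (flipPow (2 * k - t) (flipAbove t f₂ p₂))
    have hh : ∀ b, [b].count D = 0 → [b] = [U] := by
      intro b; cases b <;> simp
    obtain ⟨b, hb⟩ : ∃ b, flipPow (2 * k - t) [a] = [b] := by
      unfold flipPow; split_ifs <;> simp
    rw [hb] at c₁ c₂ l₁ ⊢
    apply hh
    simp only [List.count_append, count_map_flipStep, flipStep_D, List.length_append,
      List.length_singleton] at c₁ c₂ l₁
    have h3 : [b].count D ≤ 1 := by simpa using List.count_le_length (l := [b]) (a := D)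
    omega
  refine ⟨by omega, ht.1, ?_, by rw [e₁, e₄]; simp, by rw [e₂, e₃, e₄]; simp⟩
  rw [stepCoord, if_pos (by omega), permString_eq, hp, hsub, List.idxOf_append_of_notMem ht₁, hl]
  simp

/-- Contiguous entries of a list are complementary except for the coordinate of the step. -/
theorem listWord_step (f : Word k) {i : ℕ} (hi : i ≤ 2 * k) :
    ∃ X Y : List DyckStep, X.length = stepCoord f i ∧ listWord f i = X ++ U :: Y ∧
      listWord f ((i + 1) % (2 * k + 1)) = X.map flipStep ++ U :: Y.map flipStep := by
  rcases hi.lt_or_eq with hi | rfl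
  · have hmem : 2 * k - i ∈ rank true 1 f.1 := by rw [mem_rank, length_word]; omega
    obtain ⟨p₁, p₂, hp⟩ := List.append_of_mem hmem
    have hlen := congrArg List.length hp
    simp only [length_rank, List.length_append, List.length_cons] at hlen
    have hlt : p₁.length < f.1.toList.length := by omega
    have hf : f.1.toList = f.1.toList.take p₁.length ++
        f.1.toList[p₁.length] :: f.1.toList.drop (p₁.length + 1) := by
      rw [List.getElem_cons_drop, List.take_append_drop]
    obtain ⟨h1, h2, h3, h4, h5⟩ := listWord_split f hf hp (by simp; omega)
    rw [show 2 * k - (2 * k - i) = i by omega] at h3 h4 h5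
    refine ⟨_, _, ?_, h4, ?_⟩
    · rw [h3, length_flipPow, List.length_cons, length_flipAbove (by simp; omega)]
    · rw [Nat.mod_eq_of_lt (by omega), h5, flipPow_succ, flipPow_succ]
  -- At the closing step all letters of `f` have been flipped and the index `2k` is even, so the
  -- last entry is `0` followed by the complement of `f`.
  · refine ⟨[], f.1.toList.map flipStep, by simp [stepCoord], ?_, ?_⟩
    · rw [listWord, partialFlip_of_lt (by omega)]
      simp [flipPow]
    · rw [Nat.mod_self, listWord, partialFlip_of_le (by rw [length_word]; omega)]
      simp [flipPow, Function.comp_def]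

theorem listEntry_eq (f : Word k) {i : ℕ} (hi : i ≤ 2 * k) :
    listEntry f i = onesSet (2 * k + 1) (listWord f i) := by
  induction i with
  | zero =>
    rw [listWord, partialFlip_of_le (by rw [length_word]; omega)]
    rfl
  | succ i ih =>
    obtain ⟨X, Y, hX, h₁, h₂⟩ := listWord_step f (i := i) (by omega)
    have hl := length_listWord f i
    rw [h₁] at hl
    rw [Nat.mod_eq_of_lt (by omega)] at h₂
    rw [h₂, onesSet_complement X Y (by simp at hl; omega), listEntry, ih (by omega), ← h₁, hX]

theorem card_listEntry (f : Word k) {i : ℕ} (hi : i ≤ 2 * k) : (listEntry f i).card = k := by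
  rw [listEntry_eq f hi, card_onesSet (length_listWord f i), count_listWord f hi]

theorem mod_le_two_mul (k i : ℕ) : i % (2 * k + 1) ≤ 2 * k :=
  Nat.le_of_lt_succ (Nat.mod_lt i (by omega))

/-- The vertex of the odd graph in (cyclic) position `i` of the list of `f`. -/
def listVertex (f : Word k) (i : ℕ) : OddVertex k :=
  ⟨listEntry f (i % (2 * k + 1)), card_listEntry f (mod_le_two_mul k i)⟩

theorem listVertex_mod (f : Word k) (i : ℕ) : listVertex f (i % (2 * k + 1)) = listVertex f i := by
  simp [listVertex]

theorem listVertex_coe (f : Word k) {i : ℕ} (hi : i ≤ 2 * k) :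
    (listVertex f i).1 = listEntry f i := by
  change listEntry f (i % (2 * k + 1)) = _
  rw [Nat.mod_eq_of_lt (by omega)]

theorem listVertex_val (f : Word k) {i : ℕ} (hi : i ≤ 2 * k) :
    (listVertex f i).1 = onesSet (2 * k + 1) (listWord f i) := by
  rw [listVertex_coe f hi, listEntry_eq f hi]

theorem isListEdge_iff {f : Word k} {i : ℕ} {e : Sym2 (OddVertex k)} :
    IsListEdge f i e ↔ i ≤ 2 * k ∧ e = s(listVertex f i, listVertex f (i + 1)) := by
  refine and_congr_right fun hi => ?_
  constructor
  · rintro ⟨a, b, ha, hb, rfl⟩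
    congr 2
    · exact Subtype.ext (by rw [ha, listVertex_coe f hi])
    · exact Subtype.ext hb
  · rintro rfl
    exact ⟨_, _, listVertex_coe f hi, rfl, rfl⟩

theorem listVertex_step (f : Word k) (i : ℕ) :
    (listVertex f (i + 1)).1 = Finset.univ.filter fun c =>
      c ∉ (listVertex f i).1 ∧ c.val ≠ stepCoord f (i % (2 * k + 1)) := by
  obtain ⟨X, Y, hX, h₁, h₂⟩ := listWord_step f (mod_le_two_mul k i)
  have hl := length_listWord f (i % (2 * k + 1))
  rw [h₁] at hl
  rw [← listVertex_mod f i, ← listVertex_mod f (i + 1), listVertex_val f (mod_le_two_mul k i),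
    listVertex_val f (mod_le_two_mul k (i + 1)),
    ← Nat.mod_add_mod, h₂, onesSet_complement X Y (by simp at hl; omega), hX, h₁]

/-- The leading bit gives the parity of the index. After `0` stand `k` ones, which is the case `δ =
0` of `exists_partialFlip`. After `1` the complement has `k + 1` ones, the case `δ = 1`.
`count_partialFlip` confirms that the index found has this parity. -/
theorem exists_listVertex (v : OddVertex k) :
    ∃ (f : Word k) (i : ℕ), i ≤ 2 * k ∧ listVertex f i = v := by
  obtain ⟨l, hl, hv⟩ := exists_onesSet v.1
  have hc := card_onesSet hl
  rw [hv, v.2] at hc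
  have hUD := count_U_add_count_D l
  match l with
  | [] => simp at hl
  | U :: l =>
    simp at hc hl hUD
    obtain ⟨f, t, hf, h₁, h₂, h₃⟩ := (exists_partialFlip k l 1 0 le_rfl hl (by omega)).1 hc.symm
    have e := (count_partialFlip f 1 t (2 * k - t) (by rw [length_eq_two_mul]; omega)
      (by rw [length_eq_two_mul]; omega)).1
    rw [h₃, ← hc, hf] at e
    refine ⟨⟨f, hf⟩, 2 * k - t, by omega, Subtype.ext ?_⟩
    rw [listVertex_val _ (by omega), ← hv, listWord, show 2 * k - (2 * k - t) = t by omega,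
      flipPow, if_pos (by omega), h₃]
  | D :: l =>
    simp at hc hl hUD
    obtain ⟨f, t, hf, h₁, h₂, h₃⟩ := (exists_partialFlip k (l.map flipStep) 1 1 le_rfl
      (by simpa using hl) le_rfl).1 (by rw [count_map_flipStep, flipStep_D]; omega)
    have e := (count_partialFlip f 1 t (2 * k - t) (by rw [length_eq_two_mul]; omega)
      (by rw [length_eq_two_mul]; omega)).1
    rw [h₃, count_map_flipStep, flipStep_D, hf] at e
    refine ⟨⟨f, hf⟩, 2 * k - t, by omega, Subtype.ext ?_⟩
    rw [listVertex_val _ (by omega), ← hv, listWord, show 2 * k - (2 * k - t) = t by omega,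
      flipPow, if_neg (by omega), h₃]
    simp [Function.comp_def]

theorem catalan_mul_eq_choose (k : ℕ) : catalan k * (2 * k + 1) = (2 * k + 1).choose k := by
  have h1 : (k + 1) * catalan k = k.centralBinom := succ_mul_catalan_eq_centralBinom k
  have h2 : (2 * k + 1).choose k * (k + 1) = (2 * k + 1) * k.centralBinom := by
    have := Nat.add_one_mul_choose_eq (2 * k) k
    rw [Nat.choose_symm_of_eq_add (show 2 * k + 1 = k + (k + 1) by omega), ← this]
    rfl
  have h3 : 0 < k + 1 := by omega
  nlinarith

/-- Surjectivity suffices, because both sides have the same size by `catalan_mul_eq_choose`. This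
makes the entries of all lists distinct without tracing a vertex back to its list. -/
theorem listVertex_bijective :
    Function.Bijective fun x : Word k × Fin (2 * k + 1) => listVertex x.1 x.2 := by
  classical
  rw [Fintype.bijective_iff_surjective_and_card]
  constructor
  · intro v
    obtain ⟨f, i, hi, h⟩ := exists_listVertex v
    exact ⟨(f, ⟨i, by omega⟩), h⟩
  · rw [Fintype.card_prod, Fintype.card_fin, Fintype.card_finset_len, Fintype.card_fin,
      DyckWord.card_dyckWord_semilength_eq_catalan, catalan_mul_eq_choose]

theorem listVertex_eq_iff {f g : Word k} {i j : ℕ} :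
    listVertex f i = listVertex g j ↔ f = g ∧ i % (2 * k + 1) = j % (2 * k + 1) := by
  constructor
  · intro h
    rw [← listVertex_mod f, ← listVertex_mod g] at h
    have := @listVertex_bijective k |>.1 (a₁ := (f, ⟨_, Nat.mod_lt i (Nat.succ_pos _)⟩))
      (a₂ := (g, ⟨_, Nat.mod_lt j (Nat.succ_pos _)⟩)) h
    simpa using this
  · rintro ⟨rfl, h⟩
    rw [← listVertex_mod f, h, listVertex_mod]

end MiddleLevels

namespace MiddleLevels

open SimpleGraph symmDiff

/-! ### Gluing the cycles of a 2-factor along a further cycle -/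

section Merging

variable {V : Type*} {G : SimpleGraph V}

/-- The neighbours of a vertex along a set of edges. -/
def nbrs (E : Set (Sym2 V)) (v : V) : Set V := {w | s(v, w) ∈ E}

theorem neighborSet_fromEdgeSet {E : Set (Sym2 V)} (hE : E ⊆ G.edgeSet) (v : V) :
    (fromEdgeSet E).neighborSet v = nbrs E v := by
  ext w
  simp only [mem_neighborSet, fromEdgeSet_adj, nbrs, Set.mem_ofPred_eq, and_iff_left_iff_imp]
  intro h
  exact (G.mem_edgeSet.1 (hE h)).ne

theorem adj_fromEdgeSet {E : Set (Sym2 V)} (hE : E ⊆ G.edgeSet) {v w : V} :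
    (fromEdgeSet E).Adj v w ↔ s(v, w) ∈ E := by
  rw [← mem_neighborSet, neighborSet_fromEdgeSet hE]; rfl

theorem isCycles_fromEdgeSet {E : Set (Sym2 V)} (hE : E ⊆ G.edgeSet)
    (h2 : ∀ v, (nbrs E v).ncard = 2) : (fromEdgeSet E).IsCycles := fun v _ => by
  rw [neighborSet_fromEdgeSet hE, h2]

theorem ncard_symmDiff_eq_two {α : Type*} {A B : Set α} (hA : A.ncard = 2) (hB : B.ncard = 2)
    (h : ∃! x, x ∈ A ∧ x ∈ B) : (A ∆ B).ncard = 2 := by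
  obtain ⟨x, ⟨hxA, hxB⟩, hx⟩ := h
  have aux : ∀ S : Set α, S.ncard = 2 → x ∈ S → ∃ y, y ≠ x ∧ S = {x, y} := by
    intro S hS hxS
    obtain ⟨a, b, hab, rfl⟩ := Set.ncard_eq_two.1 hS
    rcases hxS with rfl | hxb
    · exact ⟨b, hab.symm, rfl⟩
    · rw [Set.mem_singleton_iff] at hxb
      subst hxb
      exact ⟨a, hab, Set.pair_comm _ _⟩
  obtain ⟨y, hy, rfl⟩ := aux A hA hxA
  obtain ⟨z, hz, rfl⟩ := aux B hB hxB
  have hyz : y ≠ z := by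
    rintro rfl
    exact hy (hx y (by simp))
  rw [Set.ncard_eq_two]
  refine ⟨y, z, hyz, ?_⟩
  ext a
  simp only [Set.mem_symmDiff, Set.mem_insert_iff, Set.mem_singleton_iff]
  grind

theorem nbrs_symmDiff (E D : Set (Sym2 V)) (v : V) : nbrs (E ∆ D) v = nbrs E v ∆ nbrs D v := rfl

/-- At a vertex of `D` the edge common to `E` and `D` disappears and the other edge of `D` takes its
place; elsewhere nothing changes. -/
theorem ncard_nbrs_symmDiff {E D : Set (Sym2 V)} (hE : ∀ v, (nbrs E v).ncard = 2)
    (hD : ∀ v w, s(v, w) ∈ D → (nbrs D v).ncard = 2)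
    (hDE : ∀ v w, s(v, w) ∈ D → ∃! w', s(v, w') ∈ E ∧ s(v, w') ∈ D) (v : V) :
    (nbrs (E ∆ D) v).ncard = 2 := by
  rw [nbrs_symmDiff]
  rcases (nbrs D v).eq_empty_or_nonempty with h | ⟨w, hw⟩
  · rw [h, ← Set.bot_eq_empty, symmDiff_bot, hE]
  · exact ncard_symmDiff_eq_two (hE v) (hD v w hw) (hDE v w hw)

theorem reachable_trans_of_adj {H H' : SimpleGraph V}
    (h : ∀ v w, H.Adj v w → H'.Reachable v w) {v w : V} (hvw : H.Reachable v w) :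
    H'.Reachable v w := by
  rw [reachable_iff_reflTransGen] at hvw
  induction hvw with
  | refl => exact Reachable.refl _
  | tail _ hab ih => exact ih.trans (h _ _ hab)

/-- Each lost edge of `E` lies on a cycle of `E`, and `hsep` says that the rest of that cycle
survives and bypasses it. -/
theorem reachable_symmDiff [Finite V] {E D : Set (Sym2 V)} (hEG : E ⊆ G.edgeSet)
    (hDG : D ⊆ G.edgeSet) (hE : ∀ v, (nbrs E v).ncard = 2)
    (hsep : ∀ v w v' w', s(v, w) ∈ E → s(v, w) ∈ D → s(v', w') ∈ E → s(v', w') ∈ D →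
      (fromEdgeSet E).Reachable v v' → s(v, w) = s(v', w')) {v w : V}
    (h : (fromEdgeSet E).Reachable v w ∨ (fromEdgeSet D).Reachable v w) :
    (fromEdgeSet (E ∆ D)).Reachable v w := by
  have hG : E ∆ D ⊆ G.edgeSet := fun e he => he.elim (fun h => hEG h.1) (fun h => hDG h.1)
  have key : ∀ v w, s(v, w) ∈ E → (fromEdgeSet (E ∆ D)).Reachable v w := by
    intro v w hvw
    by_cases hD : s(v, w) ∈ D
    · have h1 := (isCycles_fromEdgeSet hEG hE).reachable_deleteEdges
        ((adj_fromEdgeSet hEG).2 hvw)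
      rw [reachable_iff_reflTransGen] at h1
      have h2 : ∀ x, Relation.ReflTransGen ((fromEdgeSet E).deleteEdges {s(v, w)}).Adj v x →
          (fromEdgeSet E).Reachable v x ∧ (fromEdgeSet (E ∆ D)).Reachable v x := by
        intro x hx
        induction hx with
        | refl => exact ⟨Reachable.refl _, Reachable.refl _⟩
        | @tail a b _ hab ih =>
          rw [deleteEdges_adj, adj_fromEdgeSet hEG, Set.mem_singleton_iff] at hab
          -- The detour stays in the component of `v`, whose only edge in `D` is the deleted one.
          have hnD : s(a, b) ∉ D := fun h => hab.2 (hsep v w a b hvw hD hab.1 h ih.1).symm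
          exact ⟨ih.1.trans ((adj_fromEdgeSet hEG).2 hab.1).reachable,
            ih.2.trans ((adj_fromEdgeSet hG).2 (Or.inl ⟨hab.1, hnD⟩)).reachable⟩
      exact (h2 w h1).2
    · exact ((adj_fromEdgeSet hG).2 (Or.inl ⟨hvw, hD⟩)).reachable
  rcases h with h | h
  · exact reachable_trans_of_adj (fun a b hab => key a b ((adj_fromEdgeSet hEG).1 hab)) h
  · refine reachable_trans_of_adj (fun a b hab => ?_) h
    rw [adj_fromEdgeSet hDG] at hab
    by_cases hE' : s(a, b) ∈ E
    · exact key a b hE'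
    · exact ((adj_fromEdgeSet hG).2 (Or.inr ⟨hab, hE'⟩)).reachable

/-- A connected 2-regular set of edges is the edge set of a Hamilton cycle. -/
theorem isHamiltonCycleEdgeSet_of_connected [Finite V] [DecidableEq V] [Nonempty V]
    {E : Set (Sym2 V)} (hEG : E ⊆ G.edgeSet) (hE : ∀ v, (nbrs E v).ncard = 2)
    (hc : ∀ v w, (fromEdgeSet E).Reachable v w) : IsHamiltonCycleEdgeSet G E := by
  classical
  have := Fintype.ofFinite V
  obtain ⟨v⟩ := ‹Nonempty V›
  have hcyc := isCycles_fromEdgeSet hEG hE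
  obtain ⟨p, hp, hps⟩ := hcyc.exists_cycle_toSubgraph_verts_eq_connectedComponentSupp
    (c := (fromEdgeSet E).connectedComponentMk v) (v := v) rfl
    (by rw [neighborSet_fromEdgeSet hEG]
        exact Set.nonempty_of_ncard_ne_zero (by rw [hE]; norm_num))
  have hsupp : ∀ w, w ∈ p.support := fun w => by
    rw [← Walk.mem_verts_toSubgraph, hps]
    exact ConnectedComponent.eq.2 (hc w v)
  have hedges : ∀ e, e ∈ p.edges ↔ e ∈ E := by
    intro e
    induction e with
    | _ a b =>
      rw [← Walk.adj_toSubgraph_iff_mem_edges,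
        hp.adj_toSubgraph_iff_of_isCycles hcyc (by simpa using hsupp a), adj_fromEdgeSet hEG]
  have hle : fromEdgeSet E ≤ G := by
    intro a b h
    exact hEG ((adj_fromEdgeSet hEG).1 h)
  refine ⟨v, p.mapLe hle, ?_, ?_⟩
  · rw [Walk.isHamiltonianCycle_iff_isCycle_and_support_count_tail_eq_one]
    have hcy : (p.mapLe hle).IsCycle := hp.mapLe hle
    refine ⟨hcy, fun a => List.count_eq_one_of_mem hcy.support_nodup ?_⟩
    have hsup : (p.mapLe hle).support = p.support := by simp
    rw [hsup]
    have ha := hsupp a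
    rw [← Walk.cons_tail_support, List.mem_cons] at ha
    rcases ha with rfl | ha
    · exact Walk.end_mem_tail_support hp.not_nil
    · exact ha
  · ext e
    simp [hedges]

variable {ι : Type*}

/-- `F` is a 2-factor of `G` whose cycles are the fibres of `c`. -/
structure IsFibreFactor (G : SimpleGraph V) (c : V → ι) (F : Set (Sym2 V)) : Prop where
  subset : F ⊆ G.edgeSet
  two : ∀ v, (nbrs F v).ncard = 2
  fibre : ∀ v w, s(v, w) ∈ F → c v = c w
  reachable : ∀ v w, c v = c w → (fromEdgeSet F).Reachable v w

/-- `D` is a cycle of `G` through the fibres over `N`, with one edge inside each of them. -/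
structure IsConnector (G : SimpleGraph V) (c : V → ι) (F : Set (Sym2 V)) (N : Set ι)
    (D : Set (Sym2 V)) : Prop where
  subset : D ⊆ G.edgeSet
  two : ∀ v w, s(v, w) ∈ D → (nbrs D v).ncard = 2
  mem : ∀ v w, s(v, w) ∈ D → c v ∈ N
  fibre : ∀ v w, s(v, w) ∈ D → ∃ w', s(v, w') ∈ D ∧ c v = c w'
  factor : ∀ v w, s(v, w) ∈ D → c v = c w → s(v, w) ∈ F
  unique : ∀ v w v' w', s(v, w) ∈ D → c v = c w → s(v', w') ∈ D → c v' = c w' → c v = c v' →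
    s(v, w) = s(v', w')
  surj : ∀ f ∈ N, ∃ v w, s(v, w) ∈ D ∧ c v = f
  reachable : ∀ v w v' w', s(v, w) ∈ D → s(v', w') ∈ D → (fromEdgeSet D).Reachable v v'

end Merging

/-! ### Merging along a conflict-free spanning tree -/

section Tree

variable {k : ℕ}

theorem cliqueGraph_mono {S T : Set (Finset (MarkedWord k))} (h : S ⊆ T) :
    cliqueGraph S ≤ cliqueGraph T := fun _ _ hab =>
  ⟨hab.1, hab.2.imp fun _ hg => ⟨h hg.1, hg.2⟩⟩

/-- A connection through `S` together with the edge `gf` of the clique of `h` would be a cycle not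
contained in a single clique. -/
theorem not_reachable_of_notMem {T S : Set (Finset (MarkedWord k))} (hT : IsSpanningTree T)
    (hc : IsConflictFree T) (hST : S ⊆ T) {h : Finset (MarkedWord k)} (hh : h ∈ T) (hS : h ∉ S)
    {f g : Word k} (hf : f ∈ hVertices h) (hg : g ∈ hVertices h) (hfg : f ≠ g) :
    ¬ (cliqueGraph S).Reachable f g := by
  classical
  intro hr
  obtain ⟨p, hp⟩ := hr.exists_isPath
  have hshare : ∀ h' ∈ T, ∀ a b, a ≠ b → a ∈ hVertices h → b ∈ hVertices h →
      a ∈ hVertices h' → b ∈ hVertices h' → h' = h := by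
    intro h' hh' a b hab h1 h2 h3 h4
    by_contra hne
    exact hab ((hc h' hh' h hh hne).1 ⟨h3, h1⟩ ⟨h4, h2⟩)
  have hadj : ∀ {a b}, a ∈ hVertices h → b ∈ hVertices h → ¬ (cliqueGraph S).Adj a b := by
    rintro a b ha hb ⟨hab, h', hh', ha', hb'⟩
    exact hS (hshare h' (hST hh') a b hab ha hb ha' hb' ▸ hh')
  have hadj' : (cliqueGraph T).Adj g f := ⟨hfg.symm, h, hh, hg, hf⟩
  have hcyc : (Walk.cons hadj' (p.mapLe (cliqueGraph_mono hST))).IsCycle := by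
    rw [Walk.cons_isCycle_iff]
    refine ⟨hp.mapLe _, fun he => ?_⟩
    rw [Walk.edges_mapLe_eq_edges] at he
    exact hadj hg hf (p.adj_of_mem_edges he)
  -- The member containing the cycle shares `f` and `g` with `h`, so it is `h`. But then the first
  -- edge of the path joins two vertices of `h` through a member of `S`, which `hadj` excludes.
  obtain ⟨h', ⟨hh', hsupp⟩, -⟩ := hT.2.2.2 _ _ hcyc
  have e : h' = h := hshare h' hh' f g hfg hf hg
    (hsupp f (by simp)) (hsupp g (by simp))
  subst e
  cases p with
  | nil => exact hfg rfl
  | @cons _ b _ hab q =>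
    exact hadj hf (hsupp b (by simp)) hab

variable {V : Type*} [Finite V] {G : SimpleGraph V} {c : V → Word k} {F : Set (Sym2 V)}

/-- The invariant of flipping the hyperedges one at a time. It is stated for all finite `S ⊆ T`,
connected or not, so the order of insertion is irrelevant. -/
theorem merge {T : Set (Finset (MarkedWord k))} (hT : IsSpanningTree T) (hc : IsConflictFree T)
    (hF : IsFibreFactor G c F) {D : Finset (MarkedWord k) → Set (Sym2 V)}
    (hD : ∀ h ∈ T, IsConnector G c F (hVertices h) (D h))
    (hdisj : ∀ h ∈ T, ∀ h' ∈ T, h ≠ h' → Disjoint (D h) (D h'))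
    (S : Finset (Finset (MarkedWord k))) (hS : (S : Set (Finset (MarkedWord k))) ⊆ T) :
    F ∆ (⋃ h ∈ S, D h) ⊆ G.edgeSet ∧ (∀ v, (nbrs (F ∆ (⋃ h ∈ S, D h)) v).ncard = 2) ∧
      ∀ v w, (cliqueGraph (S : Set (Finset (MarkedWord k)))).Reachable (c v) (c w) →
        (fromEdgeSet (F ∆ (⋃ h ∈ S, D h))).Reachable v w := by
  classical
  induction S using Finset.induction_on with
  | empty =>
    simp only [Finset.notMem_empty, Set.iUnion_of_empty, Set.iUnion_empty]
    rw [← Set.bot_eq_empty, symmDiff_bot]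
    refine ⟨hF.subset, hF.two, fun v w h => hF.reachable v w ?_⟩
    rw [reachable_iff_reflTransGen] at h
    generalize c w = b at h
    induction h with
    | refl => rfl
    | tail _ hab _ => obtain ⟨-, h', hh', -⟩ := hab; simp at hh'
  | insert h S hhS ih =>
    have hh : h ∈ T := hS (by simp)
    have hST : (S : Set (Finset (MarkedWord k))) ⊆ T := fun x hx => hS (by simp_all)
    obtain ⟨ih₁, ih₂, ih₃⟩ := ih hST
    set E := F ∆ (⋃ h ∈ S, D h) with hEdef
    have hDh := hD h hh
    have hdis : ∀ e ∈ D h, e ∉ ⋃ h ∈ S, D h := by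
      intro e he he'
      simp only [Set.mem_iUnion] at he'
      obtain ⟨h', hh', he'⟩ := he'
      exact Set.disjoint_left.1 (hdisj h hh h' (hST hh') (fun e => hhS (e ▸ hh'))) he he'
    have hE' : F ∆ (⋃ h' ∈ insert h S, D h') = E ∆ D h := by
      rw [hEdef, symmDiff_assoc]
      congr 1
      rw [Finset.set_biUnion_insert]
      ext e
      simp only [Set.mem_union, Set.mem_symmDiff]
      have := hdis e
      tauto
    -- Earlier flips use none of the edges of `D h`, so its edges in `E` are still its edges in `F`,
    -- those inside a fibre.
    have hDE : ∀ v w, s(v, w) ∈ D h → (s(v, w) ∈ E ↔ c v = c w) := by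
      intro v w hvw
      have := hdis _ hvw
      rw [hEdef, Set.mem_symmDiff]
      constructor
      · rintro (h1 | h1)
        · exact hF.fibre v w h1.1
        · exact absurd h1.1 this
      · exact fun h1 => Or.inl ⟨hDh.factor v w hvw h1, this⟩
    -- The converse of the invariant: earlier flips connect only fibres linked through `S`. It is
    -- needed for `hsep`.
    have hreach : ∀ v w, (fromEdgeSet E).Reachable v w →
        (cliqueGraph (S : Set (Finset (MarkedWord k)))).Reachable (c v) (c w) := by
      intro v w hvw
      rw [reachable_iff_reflTransGen] at hvw
      induction hvw with
      | refl => exact Reachable.refl _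
      | @tail a b _ hab ih =>
        refine ih.trans ?_
        rw [adj_fromEdgeSet ih₁] at hab
        by_cases hcab : c a = c b
        · rw [hcab]
        · rcases hab with h1 | h1
          · exact absurd (hF.fibre a b h1.1) hcab
          · have h2 := h1.1
            simp only [Set.mem_iUnion] at h2
            obtain ⟨h', hh', h2⟩ := h2
            refine Adj.reachable ⟨hcab, h', hh', (hD h' (hST hh')).mem a b h2, ?_⟩
            exact (hD h' (hST hh')).mem b a (by rwa [Sym2.eq_swap])
    have hsep : ∀ v w v' w', s(v, w) ∈ E → s(v, w) ∈ D h → s(v', w') ∈ E → s(v', w') ∈ D h →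
        (fromEdgeSet E).Reachable v v' → s(v, w) = s(v', w') := by
      intro v w v' w' h1 h2 h3 h4 h5
      rw [hDE v w h2] at h1
      rw [hDE v' w' h4] at h3
      refine hDh.unique v w v' w' h2 h1 h4 h3 ?_
      by_contra hne
      exact not_reachable_of_notMem hT hc hST hh (by simpa using hhS) (hDh.mem v w h2)
        (hDh.mem v' w' h4) hne (hreach v v' h5)
    have hR := fun v w => reachable_symmDiff (v := v) (w := w) ih₁ hDh.subset ih₂ hsep
    rw [hE']
    refine ⟨?_, ncard_nbrs_symmDiff ih₂ hDh.two ?_, ?_⟩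
    · exact fun e he => he.elim (fun h => ih₁ h.1) (fun h => hDh.subset h.1)
    · intro v w hvw
      obtain ⟨w', hw', hcw⟩ := hDh.fibre v w hvw
      refine ⟨w', ⟨(hDE v w' hw').2 hcw, hw'⟩, ?_⟩
      rintro x ⟨hx₁, hx₂⟩
      rw [hDE v x hx₂] at hx₁
      exact Sym2.congr_right.1 (hDh.unique v x v w' hx₂ hx₁ hw' hcw rfl)
    -- Along a walk of lists, every clique edge is realised by some pair of vertices over its ends,
    -- and movement within a fibre is free by `ih₃`.
    · have key : ∀ f g, (cliqueGraph ((insert h S : Finset _) :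
          Set (Finset (MarkedWord k)))).Reachable f g → ∀ v w, c v = f → c w = g →
          (fromEdgeSet (E ∆ D h)).Reachable v w := by
        intro f g hfg
        rw [reachable_iff_reflTransGen] at hfg
        induction hfg with
        | refl =>
          rintro v w rfl hw
          exact hR v w (Or.inl (ih₃ v w (by rw [hw])))
        | @tail a b _ hab ih =>
          intro v w hv hw
          obtain ⟨hne, h', hh', ha, hb⟩ := hab
          rw [Finset.coe_insert, Set.mem_insert_iff] at hh'
          have hexists : ∃ x y, c x = a ∧ c y = b ∧ (fromEdgeSet (E ∆ D h)).Reachable x y := by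
            rcases hh' with rfl | hh'
            · obtain ⟨x, x', hx, hxa⟩ := hDh.surj a ha
              obtain ⟨y, y', hy, hyb⟩ := hDh.surj b hb
              exact ⟨x, y, hxa, hyb, hR x y (Or.inr (hDh.reachable x x' y y' hx hy))⟩
            · obtain ⟨x, x', hx, hxa⟩ := (hD h' (hST hh')).surj a ha
              obtain ⟨y, y', hy, hyb⟩ := (hD h' (hST hh')).surj b hb
              refine ⟨x, y, hxa, hyb, hR x y (Or.inl (ih₃ x y (Adj.reachable ?_)))⟩
              rw [hxa, hyb]
              exact ⟨hne, h', hh', ha, hb⟩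
          obtain ⟨x, y, hx, hy, hxy⟩ := hexists
          exact ((ih v x hv hx).trans hxy).trans (hR y w (Or.inl (ih₃ y w (by rw [hy, hw]))))
      exact fun v w h => key _ _ h v w rfl rfl

theorem isHamiltonCycleEdgeSet_merge [DecidableEq V] [Nonempty V]
    {T : Set (Finset (MarkedWord k))} (hfin : T.Finite) (hT : IsSpanningTree T)
    (hc : IsConflictFree T) (hF : IsFibreFactor G c F)
    {D : Finset (MarkedWord k) → Set (Sym2 V)}
    (hD : ∀ h ∈ T, IsConnector G c F (hVertices h) (D h))
    (hdisj : ∀ h ∈ T, ∀ h' ∈ T, h ≠ h' → Disjoint (D h) (D h')) :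
    IsHamiltonCycleEdgeSet G (F ∆ (⋃ h ∈ T, D h)) := by
  have h := merge hT hc hF hD hdisj hfin.toFinset (by simp)
  simp only [Set.Finite.mem_toFinset, Set.Finite.coe_toFinset] at h
  exact isHamiltonCycleEdgeSet_of_connected h.1 h.2.1 fun v w => h.2.2 v w (hT.2.2.1.preconnected _ _)

end Tree

/-! ### Cycles with one edge in each of the lists they visit -/

section Cycle

variable {V : Type*} {G : SimpleGraph V} {k : ℕ} {c : V → Word k} {F : Set (Sym2 V)}

theorem ncard_edges_of_isCycle {v : V} {p : G.Walk v v} (hp : p.IsCycle) :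
    {e | e ∈ p.edges}.ncard = p.length := by
  classical
  have : {e | e ∈ p.edges} = (p.edges.toFinset : Set (Sym2 V)) := by ext; simp
  rw [this, Set.ncard_coe_finset, List.toFinset_card_of_nodup hp.edges_nodup, Walk.length_edges]

/-- A cycle of length `2|h|` that contains one edge of the fibre over each member of `h`. -/
theorem isConnector_of_cycle (hF : IsFibreFactor G c F) {h : Finset (MarkedWord k)}
    (hinj : Set.InjOn Prod.fst (h : Set (MarkedWord k))) {D : Set (Sym2 V)}
    (hD : IsCycleEdgeSet G D) (hcard : D.ncard = 2 * h.card) {e : MarkedWord k → Sym2 V}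
    (he : ∀ m ∈ h, e m ∈ F ∧ e m ∈ D ∧ ∀ v ∈ e m, c v = m.1)
    (hdisj : ∀ m ∈ h, ∀ m' ∈ h, m ≠ m' → ∀ a ∈ e m, a ∉ e m') :
    IsConnector G c F (hVertices h) D := by
  classical
  obtain ⟨v₀, p, hp, rfl⟩ := hD
  have hlen : p.length = 2 * h.card := by rw [← hcard, ncard_edges_of_isCycle hp]
  have htail : ∀ v ∈ p.support, v ∈ p.support.tail := by
    intro v hv
    rw [← Walk.cons_tail_support, List.mem_cons] at hv
    rcases hv with rfl | hv
    · exact Walk.end_mem_tail_support hp.not_nil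
    · exact hv
  -- The disjoint edges `e m` have `2|h|` ends, and the cycle has only `2|h|` vertices.
  have hcover : ∀ v ∈ p.support, ∃ m ∈ h, v ∈ e m := by
    have hsub : h.biUnion (fun m => (e m).toFinset) ⊆ p.support.tail.toFinset := by
      intro v hv
      simp only [Finset.mem_biUnion, Sym2.mem_toFinset] at hv
      obtain ⟨m, hm, hv⟩ := hv
      rw [List.mem_toFinset]
      exact htail v (Walk.mem_support_of_mem_edges (he m hm).2.1 hv)
    have hcardU : (h.biUnion (fun m => (e m).toFinset)).card = 2 * h.card := by
      rw [Finset.card_biUnion, Finset.sum_const_nat (m := 2), mul_comm]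
      · intro m hm
        exact Sym2.card_toFinset_of_not_isDiag _ (G.not_isDiag_of_mem_edgeSet (hF.subset (he m hm).1))
      · intro m hm m' hm' hne
        rw [Function.onFun, Finset.disjoint_left]
        intro a ha
        simpa using hdisj m hm m' hm' hne a (by simpa using ha)
    have heq := Finset.eq_of_subset_of_card_le hsub (by
      rw [hcardU, List.toFinset_card_of_nodup hp.support_nodup, List.length_tail,
        Walk.length_support]
      omega)
    intro v hv
    have : v ∈ p.support.tail.toFinset := List.mem_toFinset.2 (htail v hv)
    rw [← heq] at this
    simpa using this
  have hnb : ∀ v, nbrs {e | e ∈ p.edges} v = p.toSubgraph.neighborSet v := by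
    intro v; ext w
    simp only [nbrs, Set.mem_ofPred_eq, Subgraph.mem_neighborSet]
    exact Walk.adj_toSubgraph_iff_mem_edges.symm
  have hfst : ∀ v w, s(v, w) ∈ p.edges → v ∈ p.support := fun v w h =>
    p.fst_mem_support_of_mem_edges h
  -- Members of `h` lie over different fibres, so both ends of an edge inside a fibre belong to the
  -- same `e m`.
  have huniq : ∀ v w m, m ∈ h → s(v, w) ∈ p.edges → v ∈ e m → c v = c w → e m = s(v, w) := by
    intro v w m hm hvw hv hcvw
    obtain ⟨m', hm', hw⟩ := hcover w (p.snd_mem_support_of_mem_edges hvw)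
    have hmm : m = m' := hinj hm hm' (by
      rw [← (he m hm).2.2 v hv, ← (he m' hm').2.2 w hw, hcvw])
    subst hmm
    exact (Sym2.mem_and_mem_iff (p.adj_of_mem_edges hvw).ne).1 ⟨hv, hw⟩
  have hcyc : {e | e ∈ p.edges} ⊆ G.edgeSet := fun e he => p.edges_subset_edgeSet he
  refine ⟨hcyc, ?_, ?_, ?_, ?_, ?_, ?_, ?_⟩
  · intro v w hvw
    rw [hnb, hp.ncard_neighborSet_toSubgraph_eq_two (hfst v w hvw)]
  · intro v w hvw
    obtain ⟨m, hm, hv⟩ := hcover v (hfst v w hvw)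
    rw [(he m hm).2.2 v hv]
    exact ⟨m.2, hm⟩
  · intro v w hvw
    obtain ⟨m, hm, hv⟩ := hcover v (hfst v w hvw)
    obtain ⟨w', hw'⟩ := hv
    refine ⟨w', ?_, ?_⟩
    · rw [← hw']; exact (he m hm).2.1
    · rw [(he m hm).2.2 v (by rw [hw']; simp), (he m hm).2.2 w' (by rw [hw']; simp)]
  · intro v w hvw hcvw
    obtain ⟨m, hm, hv⟩ := hcover v (hfst v w hvw)
    rw [← huniq v w m hm hvw hv hcvw]
    exact (he m hm).1
  · intro v w v' w' h1 h2 h3 h4 h5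
    obtain ⟨m, hm, hv⟩ := hcover v (hfst v w h1)
    obtain ⟨m', hm', hv'⟩ := hcover v' (hfst v' w' h3)
    have hmm : m = m' := hinj hm hm' (by
      rw [← (he m hm).2.2 v hv, ← (he m' hm').2.2 v' hv', h5])
    subst hmm
    rw [← huniq v w m hm h1 hv h2, ← huniq v' w' m hm h3 hv' h4]
  · rintro f ⟨j, hj⟩
    have h1 := he _ hj
    generalize e (f, j) = x at h1
    induction x with
    | _ a b => exact ⟨a, b, h1.2.1, h1.2.2 a (by simp)⟩
  · intro v w v' w' h1 h2
    have hq : ∀ a ∈ p.support, (fromEdgeSet {e | e ∈ p.edges}).Reachable v₀ a := by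
      intro a ha
      let q := p.transfer (fromEdgeSet {e | e ∈ p.edges}) (fun e he => by
        rw [edgeSet_fromEdgeSet]
        exact ⟨he, G.not_isDiag_of_mem_edgeSet (hcyc he)⟩)
      have ha' : a ∈ q.support := by simpa [q] using ha
      exact (q.takeUntil a ha').reachable
    exact (hq v (hfst v w h1)).symm.trans (hq v' (hfst v' w' h2))

end Cycle

end MiddleLevels

namespace MiddleLevels

open SimpleGraph symmDiff

variable {k : ℕ}

/-! ### The uniform 2-factor of the odd graph -/

/-- The Dyck word whose list contains a given vertex. -/
noncomputable def listIndex (v : OddVertex k) : Word k :=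
  ((Equiv.ofBijective _ (@listVertex_bijective k)).symm v).1

theorem exists_eq_listVertex (v : OddVertex k) : ∃ i ≤ 2 * k, v = listVertex (listIndex v) i := by
  have h := (Equiv.ofBijective _ (@listVertex_bijective k)).apply_symm_apply v
  exact ⟨_, Nat.le_of_lt_succ ((Equiv.ofBijective _ (@listVertex_bijective k)).symm v).2.2, h.symm⟩

@[simp] theorem listIndex_listVertex (f : Word k) (i : ℕ) : listIndex (listVertex f i) = f := by
  obtain ⟨j, -, hj⟩ := exists_eq_listVertex (listVertex f i)
  exact (listVertex_eq_iff.1 hj).1.symm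

theorem mem_oddFactor {e : Sym2 (OddVertex k)} :
    e ∈ oddFactor k ↔ ∃ (f : Word k) (i : ℕ), e = s(listVertex f i, listVertex f (i + 1)) := by
  constructor
  · rintro ⟨f, i, h⟩
    exact ⟨f, i, (isListEdge_iff.1 h).2⟩
  · rintro ⟨f, i, rfl⟩
    refine ⟨f, i % (2 * k + 1), isListEdge_iff.2 ⟨mod_le_two_mul k i, ?_⟩⟩
    rw [listVertex_mod, show listVertex f (i % (2 * k + 1) + 1) = listVertex f (i + 1) from
      listVertex_eq_iff.2 ⟨rfl, by simp⟩]

theorem modEq_add_two_mul {i j : ℕ} (h : i % (2 * k + 1) = (j + 1) % (2 * k + 1)) :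
    j % (2 * k + 1) = (i + 2 * k) % (2 * k + 1) := by
  have h1 : i + 2 * k ≡ j + 1 + 2 * k [MOD 2 * k + 1] := Nat.ModEq.add_right (2 * k) h
  have h2 : j + 1 + 2 * k ≡ j [MOD 2 * k + 1] := by
    rw [show j + 1 + 2 * k = j + (2 * k + 1) by ring]
    simp
  exact (h1.trans h2).symm

theorem add_mod_ne (i : ℕ) {d n : ℕ} (h0 : 0 < d) (hd : d < n) : (i + d) % n ≠ i % n := by
  intro h
  have h1 : i + d ≡ i + 0 [MOD n] := h
  have h2 := Nat.ModEq.add_left_cancel' i h1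
  rw [Nat.ModEq, Nat.mod_eq_of_lt hd, Nat.zero_mod] at h2
  omega

theorem oddGraph_adj_iff (hk : 1 ≤ k) {a b : OddVertex k} :
    (oddGraph k).Adj a b ↔ Disjoint a.1 b.1 := by
  refine ⟨fun h => h.2, fun h => ⟨?_, h⟩⟩
  rintro rfl
  rw [disjoint_self, Finset.bot_eq_empty] at h
  have := a.2
  rw [h, Finset.card_empty] at this
  omega

theorem listVertex_adj (hk : 1 ≤ k) (f : Word k) (i : ℕ) :
    (oddGraph k).Adj (listVertex f i) (listVertex f (i + 1)) := by
  rw [oddGraph_adj_iff hk, Finset.disjoint_right]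
  intro c hc
  rw [listVertex_step] at hc
  exact (Finset.mem_filter.1 hc).2.1

/-- Modulo `2k + 1`, adding `2k` is a step backwards; this avoids subtraction of indices. -/
theorem nbrs_oddFactor (f : Word k) (i : ℕ) :
    nbrs (oddFactor k) (listVertex f i) = {listVertex f (i + 1), listVertex f (i + 2 * k)} := by
  ext w
  simp only [nbrs, Set.mem_ofPred_eq, mem_oddFactor, Set.mem_insert_iff, Set.mem_singleton_iff]
  constructor
  · rintro ⟨g, j, h⟩
    rw [Sym2.eq_iff] at h
    rcases h with ⟨h1, rfl⟩ | ⟨h1, rfl⟩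
    · obtain ⟨rfl, h2⟩ := listVertex_eq_iff.1 h1
      exact Or.inl (listVertex_eq_iff.2 ⟨rfl, (Nat.ModEq.add_right 1 h2).symm⟩)
    · obtain ⟨rfl, h2⟩ := listVertex_eq_iff.1 h1
      exact Or.inr (listVertex_eq_iff.2 ⟨rfl, modEq_add_two_mul h2⟩)
  · rintro (rfl | rfl)
    · exact ⟨f, i, rfl⟩
    · refine ⟨f, i + 2 * k, ?_⟩
      rw [Sym2.eq_swap, show listVertex f (i + 2 * k + 1) = listVertex f i from
        listVertex_eq_iff.2 ⟨rfl, by rw [add_assoc, Nat.add_mod_right]⟩]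

theorem isFibreFactor_oddFactor (hk : 3 ≤ k) :
    IsFibreFactor (oddGraph k) listIndex (oddFactor k) := by
  have hsub : oddFactor k ⊆ (oddGraph k).edgeSet := by
    intro e he
    obtain ⟨f, i, rfl⟩ := mem_oddFactor.1 he
    exact listVertex_adj (by omega) f i
  refine ⟨hsub, ?_, ?_, ?_⟩
  · intro v
    obtain ⟨i, -, hv⟩ := exists_eq_listVertex v
    rw [hv, nbrs_oddFactor, Set.ncard_pair]
    intro h
    have := (listVertex_eq_iff.1 h).2
    rw [show i + 2 * k = i + 1 + (2 * k - 1) by omega] at this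
    exact add_mod_ne (i + 1) (by omega) (by omega) this.symm
  · intro v w h
    obtain ⟨f, i, h⟩ := mem_oddFactor.1 h
    rw [Sym2.eq_iff] at h
    rcases h with ⟨rfl, rfl⟩ | ⟨rfl, rfl⟩ <;> simp
  · have key : ∀ f i, (fromEdgeSet (oddFactor k)).Reachable (listVertex f 0) (listVertex f i) := by
      intro f i
      induction i with
      | zero => exact Reachable.refl _
      | succ i ih =>
        exact ih.trans ((adj_fromEdgeSet hsub).2 (mem_oddFactor.2 ⟨f, i, rfl⟩)).reachable
    intro v w h
    obtain ⟨i, -, hv⟩ := exists_eq_listVertex v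
    obtain ⟨j, -, hw⟩ := exists_eq_listVertex w
    rw [hv, hw, h]
    exact (key _ i).symm.trans (key _ j)

/-! ### The covering map -/

/-- The vertex of the middle-levels graph over `y`, in the lower (`true`) or upper level. -/
def levelVertex (s : Bool) (y : OddVertex k) : MiddleVertex k :=
  if s then ⟨y.1, Or.inl y.2⟩
  else ⟨y.1ᶜ, Or.inr (by rw [Finset.card_compl, Fintype.card_fin, y.2]; omega)⟩

/-- Whether a vertex of the middle-levels graph is in the lower level. -/
def level (a : MiddleVertex k) : Bool := decide (a.1.card = k)

theorem card_compl_oddVertex (y : OddVertex k) : (y.1ᶜ).card = k + 1 := by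
  rw [Finset.card_compl, Fintype.card_fin, y.2]; omega

@[simp] theorem covering_levelVertex (s : Bool) (y : OddVertex k) :
    covering k (levelVertex s y) = y := by
  have h := card_compl_oddVertex y
  cases s
  · simp [levelVertex, covering, h]
  · simp [levelVertex, covering, y.2]

@[simp] theorem level_levelVertex (s : Bool) (y : OddVertex k) : level (levelVertex s y) = s := by
  have h := card_compl_oddVertex y
  cases s
  · simp [levelVertex, level, h]
  · simp [levelVertex, level, y.2]

@[simp] theorem levelVertex_level_covering (a : MiddleVertex k) :
    levelVertex (level a) (covering k a) = a := by
  by_cases h : a.1.card = k <;> simp [levelVertex, level, covering, h]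

theorem middleVertex_ext {a b : MiddleVertex k} (h₁ : level a = level b)
    (h₂ : covering k a = covering k b) : a = b := by
  rw [← levelVertex_level_covering a, h₁, h₂, levelVertex_level_covering]

theorem ssubset_compl_iff (y z : OddVertex k) :
    (y.1 ⊂ z.1ᶜ ∨ z.1ᶜ ⊂ y.1) ↔ Disjoint y.1 z.1 := by
  have hy := y.2
  have hz := card_compl_oddVertex z
  constructor
  · rintro (h | h)
    · exact Finset.disjoint_left.2 fun c hc hc' => by simpa [hc'] using h.1 hc
    · have := Finset.card_lt_card h
      omega
  · intro h
    refine Or.inl ⟨fun c hc => ?_, fun hle => ?_⟩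
    · simpa using Finset.disjoint_left.1 h hc
    · have := Finset.card_le_card hle
      omega

/-- This identifies `M_k` with the bipartite double cover of `O_k`, with `level` as the second
coordinate; what follows on `M_k` rests on it. -/
theorem middleGraph_adj_iff (hk : 1 ≤ k) {a b : MiddleVertex k} :
    (middleGraph k).Adj a b ↔
      level a ≠ level b ∧ (oddGraph k).Adj (covering k a) (covering k b) := by
  have key : ∀ s t : Bool, ∀ y z : OddVertex k,
      (middleGraph k).Adj (levelVertex s y) (levelVertex t z) ↔ s ≠ t ∧ (oddGraph k).Adj y z := by
    intro s t y z
    rw [oddGraph_adj_iff hk]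
    have hle : ∀ A B : Finset (Fin (2 * k + 1)), A.card = B.card → ¬ (A ⊂ B ∨ B ⊂ A) := by
      rintro A B h (h' | h') <;> have := Finset.card_lt_card h' <;> omega
    cases s <;> cases t
    · simpa [levelVertex, middleGraph] using
        hle _ _ ((card_compl_oddVertex y).trans (card_compl_oddVertex z).symm)
    · have := ssubset_compl_iff z y
      simp only [levelVertex, middleGraph]
      simpa [or_comm, disjoint_comm] using this
    · simpa [levelVertex, middleGraph] using ssubset_compl_iff y z
    · simpa [levelVertex, middleGraph] using hle _ _ (y.2.trans z.2.symm)
  rw [← key]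
  simp

theorem mem_middleFactor (hk : 3 ≤ k) {a b : MiddleVertex k} :
    s(a, b) ∈ middleFactor k ↔
      level a ≠ level b ∧ s(covering k a, covering k b) ∈ oddFactor k := by
  simp only [middleFactor, Set.mem_ofPred_eq, mem_edgeSet, Sym2.map_mk,
    middleGraph_adj_iff (show 1 ≤ k by omega)]
  constructor
  · exact fun h => ⟨h.1.1, h.2⟩
  · exact fun h => ⟨⟨h.1, (isFibreFactor_oddFactor hk).subset h.2⟩, h.2⟩

/-- A list has odd length `2k + 1`, so one turn around it changes the level. Its preimage is
therefore a single cycle, and the fibres are again indexed by the Dyck words. -/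
theorem isFibreFactor_middleFactor (hk : 3 ≤ k) :
    IsFibreFactor (middleGraph k) (fun a => listIndex (covering k a)) (middleFactor k) := by
  have hO := isFibreFactor_oddFactor hk
  have hsub : middleFactor k ⊆ (middleGraph k).edgeSet := fun e he => he.1
  refine ⟨hsub, ?_, ?_, ?_⟩
  · intro a
    have : nbrs (middleFactor k) a =
        levelVertex (!level a) '' nbrs (oddFactor k) (covering k a) := by
      ext b
      simp only [nbrs, Set.mem_ofPred_eq, mem_middleFactor hk, Set.mem_image]
      constructor
      · rintro ⟨h1, h2⟩
        refine ⟨_, h2, ?_⟩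
        rw [show (!level a) = level b by revert h1; cases level a <;> cases level b <;> simp]
        simp
      · rintro ⟨y, hy, rfl⟩
        simpa using hy
    rw [this, Set.ncard_image_of_injective _ (fun y z h => by
      simpa using congrArg (covering k) h), hO.two]
  · intro a b h
    exact hO.fibre _ _ ((mem_middleFactor hk).1 h).2
  · have key : ∀ f i, (fromEdgeSet (middleFactor k)).Reachable
        (levelVertex true (listVertex f 0)) (levelVertex (decide (i % 2 = 0)) (listVertex f i)) := by
      intro f i
      induction i with
      | zero => exact Reachable.refl _
      | succ i ih =>
        refine ih.trans ((adj_fromEdgeSet hsub).2 ((mem_middleFactor hk).2 ⟨?_, ?_⟩)).reachable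
        · rw [level_levelVertex, level_levelVertex, ne_eq, decide_eq_decide]
          omega
        · simpa using mem_oddFactor.2 ⟨f, i, rfl⟩
    have key' : ∀ a : MiddleVertex k, (fromEdgeSet (middleFactor k)).Reachable
        (levelVertex true (listVertex (listIndex (covering k a)) 0)) a := by
      intro a
      obtain ⟨i, -, hi⟩ := exists_eq_listVertex (covering k a)
      by_cases h : level a = decide (i % 2 = 0)
      · have := key (listIndex (covering k a)) i
        rwa [← hi, ← h, levelVertex_level_covering] at this
      -- When the level is wrong, one additional turn corrects it.
      · have := key (listIndex (covering k a)) (i + (2 * k + 1))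
        rw [← listVertex_mod _ (i + (2 * k + 1)), Nat.add_mod_right, listVertex_mod, ← hi] at this
        rwa [show decide ((i + (2 * k + 1)) % 2 = 0) = level a by
          rcases Nat.mod_two_eq_zero_or_one i with h0 | h0
          · simp [h0] at h; simp [h]; omega
          · simp [h0] at h; simp [h]; omega, levelVertex_level_covering] at this
    intro a b h
    have ha := key' a
    have hb := key' b
    rw [← h] at hb
    exact ha.symm.trans hb

/-! ### Lifts -/

/-- Every step changes the level, so the lift is forced once its start is chosen. -/
theorem exists_lift_walk (hk : 1 ≤ k) {u v : OddVertex k} (p : (oddGraph k).Walk u v)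
    (a : MiddleVertex k) (ha : covering k a = u) :
    ∃ (b : MiddleVertex k) (q : (middleGraph k).Walk a b), covering k b = v ∧
      q.support.map (covering k) = p.support ∧
      q.edges.map (Sym2.map (covering k)) = p.edges ∧
      (level b = if p.length % 2 = 0 then level a else !level a) := by
  induction p generalizing a with
  | nil => exact ⟨a, Walk.nil, by simp [ha]⟩
  | @cons u w v h p ih =>
    have hadj : (middleGraph k).Adj a (levelVertex (!level a) w) := by
      rw [middleGraph_adj_iff hk]
      simpa [ha] using h
    obtain ⟨b, q, h1, h2, h3, h4⟩ := ih (levelVertex (!level a) w) (by simp)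
    refine ⟨b, Walk.cons hadj q, h1, by simp [ha, h2], by simp [ha, h3], ?_⟩
    rw [h4, Walk.length_cons, level_levelVertex]
    rcases Nat.mod_two_eq_zero_or_one p.length with h0 | h0
    · simp [h0, show (p.length + 1) % 2 = 1 by omega]
    · simp [h0, show (p.length + 1) % 2 = 0 by omega]

/-- After an even number of steps the lifted walk is back on its initial level and hence closed; it
has no repetitions because its image has none. -/
theorem exists_isLift (hk : 1 ≤ k) {D : Set (Sym2 (OddVertex k))}
    (hD : IsCycleEdgeSet (oddGraph k) D) (heven : Even D.ncard) : ∃ D', IsLift D D' := by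
  obtain ⟨v, p, hp, rfl⟩ := hD
  rw [ncard_edges_of_isCycle hp, Nat.even_iff] at heven
  obtain ⟨b, q, h1, h2, h3, h4⟩ := exists_lift_walk hk p (levelVertex true v) (by simp)
  rw [if_pos heven] at h4
  obtain rfl : b = levelVertex true v := middleVertex_ext h4 (by simp [h1])
  refine ⟨{e | e ∈ q.edges}, ⟨_, q, ?_, rfl⟩, ?_, ?_, ?_⟩
  · rw [Walk.isCycle_def, Walk.isTrail_def] at hp ⊢
    refine ⟨?_, ?_, ?_⟩
    · exact List.Nodup.of_map (Sym2.map (covering k)) (h3 ▸ hp.1)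
    · rintro rfl
      apply hp.2.1
      rw [Walk.eq_nil_iff_nil, ← Walk.edges_eq_nil, ← h3]
      rfl
    · refine List.Nodup.of_map (covering k) ?_
      rw [List.map_tail, h2]
      exact hp.2.2
  · intro e he
    simp only [Set.mem_ofPred_eq, ← h3]
    exact List.mem_map_of_mem he
  · exact fun e he e' he' h => List.inj_on_of_nodup_map (h3 ▸ hp.edges_nodup) he he' h
  · intro e he
    simp only [Set.mem_ofPred_eq, ← h3, List.mem_map] at he
    exact he

/-! ### Flipping cycles as connectors -/

theorem isFlippableTuple_iff {m : MarkedWord k} {e : Sym2 (OddVertex k)} :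
    IsFlippableTuple m e ↔ ∃ i, i ≤ 2 * k ∧ stepCoord m.1 i + m.2 = 2 * k ∧
      e = s(listVertex m.1 i, listVertex m.1 (i + 1)) := by
  simp only [IsFlippableTuple, isListEdge_iff]
  exact exists_congr fun i => by tauto

theorem IsFlippableTuple.mem_oddFactor {m : MarkedWord k} {e : Sym2 (OddVertex k)}
    (h : IsFlippableTuple m e) : e ∈ oddFactor k := by
  obtain ⟨i, -, -, h⟩ := isFlippableTuple_iff.1 h
  exact MiddleLevels.mem_oddFactor.2 ⟨_, i, h⟩

theorem IsFlippableTuple.listIndex_eq {m : MarkedWord k} {e : Sym2 (OddVertex k)}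
    (h : IsFlippableTuple m e) {v : OddVertex k} (hv : v ∈ e) : listIndex v = m.1 := by
  obtain ⟨i, -, -, rfl⟩ := isFlippableTuple_iff.1 h
  rcases Sym2.mem_iff.1 hv with rfl | rfl <;> simp

/-- An edge of a list determines the step it belongs to, and the step determines the position. -/
theorem IsFlippableTuple.position_eq (hk : 3 ≤ k) {f : Word k} {i j : ℕ}
    {e : Sym2 (OddVertex k)} (h : IsFlippableTuple (f, i) e) (h' : IsFlippableTuple (f, j) e) :
    i = j := by
  obtain ⟨a, ha, hai, rfl⟩ := isFlippableTuple_iff.1 h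
  obtain ⟨b, hb, hbj, he⟩ := isFlippableTuple_iff.1 h'
  simp only at hai hbj he
  suffices a = b by subst this; omega
  rw [Sym2.eq_iff] at he
  simp only [listVertex_eq_iff, true_and] at he
  rcases he with ⟨h1, -⟩ | ⟨h1, h2⟩
  · rwa [Nat.mod_eq_of_lt (by omega), Nat.mod_eq_of_lt (by omega)] at h1
  -- Matching the ends crosswise would identify the indices `b` and `b + 2` modulo `2k + 1`.
  · exfalso
    have h3 := (Nat.ModEq.add_right 1 h1).symm.trans h2
    exact add_mod_ne b (d := 2) (by omega) (by omega) h3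

theorem IsFlippingCycle.isConnector (hk : 3 ≤ k) {h : Finset (MarkedWord k)}
    {D : Set (Sym2 (OddVertex k))} (hD : IsFlippingCycle h D) :
    IsConnector (oddGraph k) listIndex (oddFactor k) (hVertices h) D := by
  obtain ⟨h1, -, h3, h4, e, h5, h6⟩ := hD
  exact isConnector_of_cycle (isFibreFactor_oddFactor hk) h1 h3 h4
    (fun m hm => ⟨(h5 m hm).1.mem_oddFactor, (h5 m hm).2, fun v hv => (h5 m hm).1.listIndex_eq hv⟩)
    h6

theorem IsFlippingCycle.isConnector_lift (hk : 3 ≤ k) {h : Finset (MarkedWord k)}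
    {D : Set (Sym2 (OddVertex k))} (hD : IsFlippingCycle h D) {D' : Set (Sym2 (MiddleVertex k))}
    (hD' : IsLift D D') :
    IsConnector (middleGraph k) (fun a => listIndex (covering k a)) (middleFactor k)
      (hVertices h) D' := by
  obtain ⟨h1, -, h3, h4, e, h5, h6⟩ := hD
  obtain ⟨hc, hb⟩ := hD'
  have hcard : D'.ncard = 2 * h.card := by
    rw [← h4, ← hb.image_eq, hb.injOn.ncard_image]
  have hex : ∀ m, ∃ e' : Sym2 (MiddleVertex k), m ∈ h → e' ∈ D' ∧ e'.map (covering k) = e m := by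
    intro m
    by_cases hm : m ∈ h
    · obtain ⟨e', he', he''⟩ := hb.surjOn (h5 m hm).2
      exact ⟨e', fun _ => ⟨he', he''⟩⟩
    · obtain ⟨v, p, hp, -⟩ := hc
      -- An arbitrary value outside `h`.
      exact ⟨s(v, v), fun h => absurd h hm⟩
  choose e' he' using hex
  have hmem : ∀ m ∈ h, ∀ v ∈ e' m, covering k v ∈ e m := by
    intro m hm v hv
    rw [← (he' m hm).2]
    exact Sym2.mem_map.2 ⟨v, hv, rfl⟩
  refine isConnector_of_cycle (isFibreFactor_middleFactor hk) h1 hc hcard (e := e') ?_ ?_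
  · intro m hm
    refine ⟨⟨?_, ?_⟩, (he' m hm).1, fun v hv => (h5 m hm).1.listIndex_eq (hmem m hm v hv)⟩
    · obtain ⟨v, p, hp, rfl⟩ := hc
      exact p.edges_subset_edgeSet (he' m hm).1
    · rw [(he' m hm).2]
      exact (h5 m hm).1.mem_oddFactor
  · intro m hm m' hm' hne a ha ha'
    exact h6 m hm m' hm' hne _ (hmem m hm a ha) (hmem m' hm' a ha')

/-- The ends of a common edge lie in lists belonging to both hyperedges, hence in one and the same
list. There the edge is the flippable tuple of both, so their positions agree, against
conflict-freeness. -/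
theorem disjoint_flippingCycles (hk : 3 ≤ k) {T : Set (Finset (MarkedWord k))}
    (hc : IsConflictFree T) {h h' : Finset (MarkedWord k)} (hh : h ∈ T) (hh' : h' ∈ T)
    (hne : h ≠ h') {D D' : Set (Sym2 (OddVertex k))} (hD : IsFlippingCycle h D)
    (hD' : IsFlippingCycle h' D') : Disjoint D D' := by
  have key : ∀ (g : Finset (MarkedWord k)) (C : Set (Sym2 (OddVertex k))), IsFlippingCycle g C →
      ∀ v w, s(v, w) ∈ C → listIndex v = listIndex w →
      ∃ j, (listIndex v, j) ∈ g ∧ IsFlippableTuple (listIndex v, j) s(v, w) := by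
    intro g C hC v w hvw hv
    have hcon := hC.isConnector hk
    obtain ⟨j, hj⟩ := hcon.mem v w hvw
    obtain ⟨-, -, -, -, e, h5, -⟩ := hC
    obtain ⟨h6, h7⟩ := h5 _ hj
    refine ⟨j, hj, ?_⟩
    generalize e (listIndex v, j) = x at h6 h7
    induction x with
    | _ a b =>
      have ha := h6.listIndex_eq (v := a) (by simp)
      have hb := h6.listIndex_eq (v := b) (by simp)
      rwa [hcon.unique v w a b hvw hv h7 (ha.trans hb.symm) ha.symm]
  rw [Set.disjoint_left]
  intro e he he'
  induction e with
  | _ v w =>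
    have c₁ := hD.isConnector hk
    have c₂ := hD'.isConnector hk
    have he₁ : s(w, v) ∈ D := by rwa [Sym2.eq_swap]
    have he₂ : s(w, v) ∈ D' := by rwa [Sym2.eq_swap]
    have hvw : listIndex v = listIndex w :=
      (hc h hh h' hh' hne).1 ⟨c₁.mem v w he, c₂.mem v w he'⟩ ⟨c₁.mem w v he₁, c₂.mem w v he₂⟩
    obtain ⟨i, hi, hi'⟩ := key h D hD v w he hvw
    obtain ⟨j, hj, hj'⟩ := key h' D' hD' v w he' hvw
    exact (hc h hh h' hh' hne).2 _ i j hi hj (hi'.position_eq hk hj')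

/-- Positions are arbitrary natural numbers, so finiteness needs an argument. A hyperedge with a
flipping cycle has at least two vertices, so within `T` it is determined by its vertex set. -/
theorem finite_of_isConflictFree {T : Set (Finset (MarkedWord k))} (hc : IsConflictFree T)
    {D : Finset (MarkedWord k) → Set (Sym2 (OddVertex k))}
    (hD : ∀ h ∈ T, IsFlippingCycle h (D h)) : T.Finite := by
  refine Set.Finite.of_finite_image (f := hVertices) (Set.toFinite _) ?_
  intro g hg h hh e
  by_contra hne
  obtain ⟨h1, -, ⟨v, p, hp, h3⟩, h4, -⟩ := hD g hg
  rw [← h3, ncard_edges_of_isCycle hp] at h4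
  have := hp.three_le_length
  obtain ⟨m, hm, m', hm', hmm⟩ := Finset.one_lt_card.1 (show 1 < g.card by omega)
  have hs := (hc g hg h hh hne).1
  rw [← e, Set.inter_self] at hs
  exact hmm (h1 hm hm' (hs ⟨m.2, hm⟩ ⟨m'.2, hm'⟩))

theorem hamilton_of_spanningTree (hk : 3 ≤ k) {T : Set (Finset (MarkedWord k))}
    (hT : IsSpanningTree T) (hc : IsConflictFree T)
    {D : Finset (MarkedWord k) → Set (Sym2 (OddVertex k))}
    (hD : ∀ h ∈ T, IsFlippingCycle h (D h)) :
    IsHamiltonCycleEdgeSet (oddGraph k) (oddFlip T D) ∧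
    ∀ D' : Finset (MarkedWord k) → Set (Sym2 (MiddleVertex k)), (∀ h ∈ T, IsLift (D h) (D' h)) →
      IsHamiltonCycleEdgeSet (middleGraph k) (middleFlip T D') := by
  have hfin := finite_of_isConflictFree hc hD
  obtain ⟨f⟩ := hT.2.2.1.nonempty
  have hO : Nonempty (OddVertex k) := ⟨listVertex f 0⟩
  have hM : Nonempty (MiddleVertex k) := ⟨levelVertex true (listVertex f 0)⟩
  have hdisj : ∀ h ∈ T, ∀ h' ∈ T, h ≠ h' → Disjoint (D h) (D h') := fun h hh h' hh' hne =>
    disjoint_flippingCycles hk hc hh hh' hne (hD h hh) (hD h' hh')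
  refine ⟨isHamiltonCycleEdgeSet_merge hfin hT hc (isFibreFactor_oddFactor hk)
    (fun h hh => (hD h hh).isConnector hk) hdisj, fun D' hD' => ?_⟩
  refine isHamiltonCycleEdgeSet_merge hfin hT hc (isFibreFactor_middleFactor hk)
    (fun h hh => (hD h hh).isConnector_lift hk (hD' h hh)) fun h hh h' hh' hne => ?_
  rw [Set.disjoint_left]
  intro e he he'
  exact Set.disjoint_left.1 (hdisj h hh h' hh' hne) ((hD' h hh).2.mapsTo he)
    ((hD' h' hh').2.mapsTo he')

end MiddleLevels

namespace MiddleLevels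

open DyckStep SimpleGraph

/-! ### Partially flipped words in context -/

/-- The complement of a string if `c` is true, and the string itself otherwise. -/
def complementIf (c : Bool) (l : List DyckStep) : List DyckStep :=
  if c then l.map flipStep else l

@[simp] theorem complementIf_true (l : List DyckStep) : complementIf true l = l.map flipStep := rfl

@[simp] theorem complementIf_false (l : List DyckStep) : complementIf false l = l := rfl

/-- Both bracketing letters of a block while its interior is being flipped. -/
def bracket (b : Bool) : DyckStep := if b then D else U

@[simp] theorem bracket_true : bracket true = D := rfl

@[simp] theorem bracket_false : bracket false = U := rfl

/-- When the process that flips the letters of `f` in the order of decreasing ranks reaches some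
letter of `f`, the strings before and after that letter are `z₁` and `z₂`. -/
def IsWindow (b : Bool) (f : DyckWord) (z₁ z₂ : List DyckStep) : Prop :=
  ∀ s, ∃ (f₁ : List DyckStep) (a : DyckStep) (f₂ : List DyckStep) (p₁ : List ℕ) (t : ℕ)
    (p₂ : List ℕ), f.toList = f₁ ++ a :: f₂ ∧ rank b s f = p₁ ++ t :: p₂ ∧
      f₁.length = p₁.length ∧ f₂.length = p₂.length ∧
      flipAbove t f₁ p₁ = z₁ ∧ flipAbove t f₂ p₂ = z₂

/-- The ranks of `g` are all above those of `f` in the increasing orientation and all below in the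
decreasing one, so `g` has been flipped completely or not at all. `IsWindow.add_left` is the mirror
case. -/
theorem IsWindow.add_right {b : Bool} {f : DyckWord} {z₁ z₂ : List DyckStep}
    (h : IsWindow b f z₁ z₂) (g : DyckWord) :
    IsWindow b (f + g) z₁ (z₂ ++ complementIf b g.toList) := by
  intro s
  cases b
  · obtain ⟨f₁, a, f₂, p₁, t, p₂, h1, h2, h3, h4, h5, h6⟩ := h (s + g.toList.length)
    have ht : t ∈ rank false (s + g.toList.length) f := by simp [h2]
    rw [mem_rank] at ht
    refine ⟨f₁, a, f₂ ++ g.toList, p₁, t, p₂ ++ rank false s g, by simp [h1],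
      by simp [rank_false_add, h2], h3, by simp [h4], h5, ?_⟩
    rw [flipAbove_append h4, h6, flipAbove_of_le (by simp)]
    · rfl
    · intro n hn; rw [mem_rank] at hn; omega
  · obtain ⟨f₁, a, f₂, p₁, t, p₂, h1, h2, h3, h4, h5, h6⟩ := h s
    have ht : t ∈ rank true s f := by simp [h2]
    rw [mem_rank] at ht
    refine ⟨f₁, a, f₂ ++ g.toList, p₁, t, p₂ ++ rank true (s + f.toList.length) g, by simp [h1],
      by simp [rank_true_add, h2], h3, by simp [h4], h5, ?_⟩
    rw [flipAbove_append h4, h6, flipAbove_of_lt (by simp)]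
    · rfl
    · intro n hn; rw [mem_rank] at hn; omega

theorem IsWindow.add_left {b : Bool} {g : DyckWord} {z₁ z₂ : List DyckStep}
    (h : IsWindow b g z₁ z₂) (f : DyckWord) :
    IsWindow b (f + g) (complementIf (!b) f.toList ++ z₁) z₂ := by
  intro s
  cases b
  · obtain ⟨f₁, a, f₂, p₁, t, p₂, h1, h2, h3, h4, h5, h6⟩ := h s
    have ht : t ∈ rank false s g := by simp [h2]
    rw [mem_rank] at ht
    refine ⟨f.toList ++ f₁, a, f₂, rank false (s + g.toList.length) f ++ p₁, t, p₂, by simp [h1],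
      by simp [rank_false_add, h2], by simp [h3], h4, ?_, h6⟩
    rw [flipAbove_append (by simp), h5, flipAbove_of_lt (by simp)]
    · rfl
    · intro n hn; rw [mem_rank] at hn; omega
  · obtain ⟨f₁, a, f₂, p₁, t, p₂, h1, h2, h3, h4, h5, h6⟩ := h (s + f.toList.length)
    have ht : t ∈ rank true (s + f.toList.length) g := by simp [h2]
    rw [mem_rank] at ht
    refine ⟨f.toList ++ f₁, a, f₂, rank true s f ++ p₁, t, p₂, by simp [h1],
      by simp [rank_true_add, h2], by simp [h3], h4, ?_, h6⟩
    rw [flipAbove_append (by simp), h5, flipAbove_of_le (by simp)]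
    · rfl
    · intro n hn; rw [mem_rank] at hn; omega

/-- One bracketing letter has the largest rank of its block and the other the smallest. While the
interior is processed exactly one of them has been flipped, so both letters are equal. -/
theorem IsWindow.nest {b : Bool} {g : DyckWord} {z₁ z₂ : List DyckStep}
    (h : IsWindow (!b) g z₁ z₂) :
    IsWindow b g.nest (bracket b :: z₁) (z₂ ++ [bracket b]) := by
  intro s
  obtain ⟨f₁, a, f₂, p₁, t, p₂, h1, h2, h3, h4, h5, h6⟩ := h (s + 1)
  have ht : t ∈ rank (!b) (s + 1) g := by simp [h2]
  rw [mem_rank] at ht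
  cases b
  · refine ⟨U :: f₁, a, f₂ ++ [D], s :: p₁, t, p₂ ++ [s + g.toList.length + 1], by simp [h1],
      ?_, by simp [h3], by simp [h4], ?_, ?_⟩
    · simp only [Bool.not_false] at h2
      simp [rank_false_nest, h2]
    · rw [flipAbove_cons, if_neg (by omega), h5]; rfl
    · rw [flipAbove_append h4, h6, flipAbove_cons, if_pos (by omega)]; rfl
  · refine ⟨U :: f₁, a, f₂ ++ [D], (s + g.toList.length + 1) :: p₁, t, p₂ ++ [s], by simp [h1],
      ?_, by simp [h3], by simp [h4], ?_, ?_⟩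
    · simp only [Bool.not_true] at h2
      simp [rank_true_nest, h2]
    · rw [flipAbove_cons, if_pos (by omega), h5]; rfl
    · rw [flipAbove_append h4, h6, flipAbove_cons, if_neg (by omega)]; rfl

theorem isWindow_opening (b : Bool) (g : DyckWord) :
    IsWindow b g.nest [] (complementIf (!b) g.toList ++ [bracket b]) := by
  intro s
  cases b
  · refine ⟨[], U, g.toList ++ [D], [], s, rank true (s + 1) g ++ [s + g.toList.length + 1],
      by simp, by simp [rank_false_nest], rfl, by simp, rfl, ?_⟩
    rw [flipAbove_append (by simp), flipAbove_of_lt (by simp), flipAbove_cons, if_pos (by omega)]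
    · rfl
    · intro n hn; rw [mem_rank] at hn; omega
  · refine ⟨[], U, g.toList ++ [D], [], s + g.toList.length + 1, rank false (s + 1) g ++ [s],
      by simp, by simp [rank_true_nest], rfl, by simp, rfl, ?_⟩
    rw [flipAbove_append (by simp), flipAbove_of_le (by simp), flipAbove_cons, if_neg (by omega)]
    · rfl
    · intro n hn; rw [mem_rank] at hn; omega

theorem isWindow_closing (b : Bool) (g : DyckWord) :
    IsWindow b g.nest (bracket b :: complementIf b g.toList) [] := by
  intro s
  cases b
  · refine ⟨U :: g.toList, D, [], s :: rank true (s + 1) g, s + g.toList.length + 1, [],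
      by simp, by simp [rank_false_nest], by simp, rfl, ?_, rfl⟩
    rw [flipAbove_cons, if_neg (by omega), flipAbove_of_le (by simp)]
    · rfl
    · intro n hn; rw [mem_rank] at hn; omega
  · refine ⟨U :: g.toList, D, [], (s + g.toList.length + 1) :: rank false (s + 1) g, s, [],
      by simp, by simp [rank_true_nest], by simp, rfl, ?_, rfl⟩
    rw [flipAbove_cons, if_pos (by omega), flipAbove_of_lt (by simp)]
    · rfl
    · intro n hn; rw [mem_rank] at hn; omega

theorem exists_insert {F x : DyckWord} {u v : List DyckStep} (hF : F.toList = u ++ v) :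
    ∃ G : DyckWord, G.toList = u ++ x.toList ++ v := by
  have hc := F.count_U_eq_count_D
  have hx := x.count_U_eq_count_D
  rw [hF] at hc
  simp only [List.count_append] at hc
  refine exists_dyckWord (by simp only [List.count_append]; omega) fun i => ?_
  have hFi : ∀ j, ((u ++ v).take j).count D ≤ ((u ++ v).take j).count U := fun j => by
    rw [← hF]; exact F.count_D_le_count_U j
  have hxi := x.count_D_le_count_U (i - u.length)
  rw [List.append_assoc, List.take_append, List.take_append]
  simp only [List.count_append]
  by_cases h : i ≤ u.length + x.toList.length
  · have h1 := hFi (min i u.length)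
    rw [List.take_append, show min i u.length - u.length = 0 by omega,
      show i - u.length - x.toList.length = 0 by omega] at *
    simp only [List.take_zero, List.append_nil, List.count_nil, add_zero] at *
    have : u.take (min i u.length) = u.take i := by
      rw [List.take_eq_take_iff]; omega
    rw [this] at h1
    omega
  · have h1 := hFi (i - x.toList.length)
    rw [List.take_append, List.take_of_length_le (l := u) (by omega),
      show i - x.toList.length - u.length = i - u.length - x.toList.length by omega] at h1
    rw [List.take_of_length_le (l := u) (by omega),
      List.take_of_length_le (l := x.toList) (by omega)]
    simp only [List.count_append] at h1
    omega

theorem exists_remove {G x : DyckWord} {u v : List DyckStep}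
    (hG : G.toList = u ++ x.toList ++ v) : ∃ F : DyckWord, F.toList = u ++ v := by
  have hc := G.count_U_eq_count_D
  have hx := x.count_U_eq_count_D
  rw [hG] at hc
  simp only [List.count_append] at hc
  refine exists_dyckWord (by simp only [List.count_append]; omega) fun i => ?_
  by_cases h : i ≤ u.length
  · have h1 := G.count_D_le_count_U i
    rw [hG, List.append_assoc, List.take_append_of_le_length h] at h1
    rwa [List.take_append_of_le_length h]
  · have h1 := G.count_D_le_count_U (i + x.toList.length)
    rw [hG, List.take_append, List.take_append, List.take_of_length_le (l := u) (by omega),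
      List.take_of_length_le (l := x.toList) (by omega), List.length_append,
      show i + x.toList.length - (u.length + x.toList.length) = i - u.length by omega] at h1
    rw [List.take_append, List.take_of_length_le (l := u) (by omega)]
    simp only [List.count_append] at *
    omega

/-- How the letters around a factor of a Dyck word are flipped does not depend on the factor. -/
theorem exists_frame (F : DyckWord) (u v : List DyckStep) (hF : F.toList = u ++ v) (b : Bool) :
    ∃ (b' : Bool) (P Q : List DyckStep), Q.length = v.length ∧ ∀ x G : DyckWord,
      G.toList = u ++ x.toList ++ v → ∀ z₁ z₂, IsWindow b' x z₁ z₂ →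
        IsWindow b G (P ++ z₁) (z₂ ++ Q) := by
  induction F using dyck_induction generalizing u v b with
  | zero =>
    obtain ⟨rfl, rfl⟩ := List.append_eq_nil_iff.1 hF.symm
    refine ⟨b, [], [], rfl, fun x G hG z₁ z₂ h => ?_⟩
    obtain rfl : G = x := DyckWord.ext (by simpa using hG)
    simpa using h
  | step g h ihg ihh =>
    match u with
    | [] =>
      refine ⟨b, [], complementIf b (g.nest + h).toList, ?_, fun x G hG z₁ z₂ hx => ?_⟩
      · rw [List.nil_append] at hF
        rw [← hF]; cases b <;> simp
      · rw [List.nil_append] at hF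
        obtain rfl : G = x + (g.nest + h) := DyckWord.ext (by rw [hG, ← hF]; simp)
        exact hx.add_right _
    | a :: u =>
      simp only [toList_add, toList_nest, List.cons_append, List.append_assoc,
        List.cons_eq_cons] at hF
      obtain ⟨rfl, hF⟩ := hF
      -- An insertion point inside the first block: the frame of `g` is taken in the opposite
      -- orientation and then extended by the brackets and by `h`.
      have inside : ∀ v', g.toList = u ++ v' → v = v' ++ D :: h.toList → ∃ (b' : Bool)
          (P Q : List DyckStep), Q.length = v.length ∧ ∀ x G : DyckWord,
          G.toList = U :: u ++ x.toList ++ v → ∀ z₁ z₂, IsWindow b' x z₁ z₂ →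
          IsWindow b G (P ++ z₁) (z₂ ++ Q) := by
        rintro v' hg rfl
        obtain ⟨b', P, Q, hQ, hw⟩ := ihg u v' hg (!b)
        refine ⟨b', bracket b :: P, Q ++ bracket b :: complementIf b h.toList, ?_,
          fun x G hG z₁ z₂ hx => ?_⟩
        · cases b <;> simp [hQ]
        · obtain ⟨G', hG'⟩ := exists_insert (x := x) hg
          obtain rfl : G = G'.nest + h := DyckWord.ext (by rw [hG]; simp [hG'])
          have := ((hw x G' hG' z₁ z₂ hx).nest).add_right h
          simpa using this
      rcases List.append_eq_append_iff.1 hF with ⟨c, h1, h2⟩ | ⟨c, h1, h2⟩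
      · match c with
        | [] => exact inside [] (by simp [h1]) (by simpa using h2.symm)
        | d :: c =>
          simp only [List.cons_append, List.cons_eq_cons] at h2
          obtain ⟨rfl, h2⟩ := h2
          obtain ⟨b', P, Q, hQ, hw⟩ := ihh c v h2 b
          refine ⟨b', complementIf (!b) g.nest.toList ++ P, Q, hQ, fun x G hG z₁ z₂ hx => ?_⟩
          obtain ⟨G', hG'⟩ := exists_insert (x := x) h2
          obtain rfl : G = g.nest + G' := DyckWord.ext (by rw [hG, h1]; simp [hG'])
          have := (hw x G' hG' z₁ z₂ hx).add_left g.nest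
          simpa using this
      · exact inside c h1 (by simpa using h2)

variable {k : ℕ}

/-- The parity of the step only decides which end of the tuple comes first in the list. Naming the
ends by their leading bit removes it from all that follows. -/
theorem exists_flippableTuple (f : Word k) {z₁ z₂ : List DyckStep}
    (h : IsWindow true f.1 z₁ z₂) :
    ∃ α β : OddVertex k, α.1 = onesSet (2 * k + 1) (U :: z₁ ++ U :: z₂) ∧
      β.1 = onesSet (2 * k + 1) (D :: z₁.map flipStep ++ U :: z₂.map flipStep) ∧
      IsFlippableTuple (f, z₂.length) s(α, β) := by
  obtain ⟨f₁, a, f₂, p₁, t, p₂, h1, h2, h3, h4, rfl, rfl⟩ := h 1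
  obtain ⟨h5, h6, h7, h8, h9⟩ := listWord_split f h1 h2 h3
  have v₁ := listVertex_val f (i := 2 * k - t) (by omega)
  have v₂ := listVertex_val f (i := 2 * k - t + 1) (by omega)
  have hlen := length_word f
  have hz := length_flipAbove (t := t) h4
  rw [h1, List.length_append, List.length_cons] at hlen
  rw [h8] at v₁
  rw [h9] at v₂
  rcases Nat.mod_two_eq_zero_or_one (2 * k - t) with hp | hp
  · refine ⟨listVertex f (2 * k - t), listVertex f (2 * k - t + 1), ?_, ?_,
      isFlippableTuple_iff.2 ⟨2 * k - t, by omega, ?_, rfl⟩⟩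
    · rw [v₁]; simp [flipPow, hp]
    · rw [v₂]; simp [flipPow, show (2 * k - t + 1) % 2 = 1 by omega]
    · rw [h7, hz]; omega
  · refine ⟨listVertex f (2 * k - t + 1), listVertex f (2 * k - t), ?_, ?_,
      isFlippableTuple_iff.2 ⟨2 * k - t, by omega, ?_, Sym2.eq_swap⟩⟩
    · rw [v₂]; simp [flipPow, show (2 * k - t + 1) % 2 = 0 by omega]
    · rw [v₁]; simp [flipPow, hp]
    · rw [h7, hz]; omega

/-- Two strings have no letter `1` at a common position. -/
def NoCommonOne (l l' : List DyckStep) : Prop :=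
  List.Forall₂ (fun a b => a = U ∨ b = U) l l'

theorem NoCommonOne.append {l l' m m' : List DyckStep} (h : NoCommonOne l l')
    (h' : NoCommonOne m m') : NoCommonOne (l ++ m) (l' ++ m') :=
  List.rel_append h h'

theorem noCommonOne_complement (l : List DyckStep) : NoCommonOne (l.map flipStep) l := by
  induction l with
  | nil => exact List.Forall₂.nil
  | cons a l ih => exact List.Forall₂.cons (by cases a <;> simp) ih

theorem noCommonOne_complement' (l : List DyckStep) : NoCommonOne l (l.map flipStep) := by
  induction l with
  | nil => exact List.Forall₂.nil
  | cons a l ih => exact List.Forall₂.cons (by cases a <;> simp) ih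

theorem NoCommonOne.disjoint {l l' : List DyckStep} (h : NoCommonOne l l') (n : ℕ) :
    Disjoint (onesSet n l) (onesSet n l') := by
  rw [Finset.disjoint_left]
  intro c hc hc'
  rw [mem_onesSet] at hc hc'
  obtain ⟨h1, h2⟩ := List.getElem?_eq_some_iff.1 hc
  obtain ⟨h3, h4⟩ := List.getElem?_eq_some_iff.1 hc'
  have := List.Forall₂.get h h1 h3
  simp [h2, h4] at this

/-- The second end of the tuple with window `z` is adjacent to the first end of the tuple with
window `w`. -/
def Follows (z w : List DyckStep × List DyckStep) : Prop :=
  NoCommonOne (z.1.map flipStep ++ U :: z.2.map flipStep) (w.1 ++ U :: w.2)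

/-! ### Flipping cycles -/

theorem isCycle_cons_of_nodup {V : Type*} {G : SimpleGraph V} {a b : V} (h : G.Adj a b)
    (p : G.Walk b a) (hp : p.support.Nodup) (hlen : 2 ≤ p.length) : (Walk.cons h p).IsCycle := by
  rw [Walk.cons_isCycle_iff]
  refine ⟨(Walk.isPath_def p).2 hp, fun he => ?_⟩
  cases p with
  | nil => simp at hlen
  | @cons _ c _ h' q =>
    rw [Walk.support_cons, List.nodup_cons] at hp
    rw [Walk.edges_cons, List.mem_cons] at he
    rcases he with he | he
    · obtain rfl : a = c := by
        rcases Sym2.eq_iff.1 he with ⟨rfl, -⟩ | ⟨rfl, -⟩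
        · exact absurd rfl h.ne
        · rfl
      have hq := Walk.isPath_iff_nil.1 ((Walk.isPath_def q).2 hp.2)
      have := Walk.length_eq_zero_iff.2 hq
      simp [this] at hlen
    · exact hp.1 (q.snd_mem_support_of_mem_edges he)

theorem IsFlippableTuple.adj (hk : 3 ≤ k) {m : MarkedWord k} {a b : OddVertex k}
    (h : IsFlippableTuple m s(a, b)) : (oddGraph k).Adj a b :=
  (isFibreFactor_oddFactor hk).subset h.mem_oddFactor

/-- The tuples are automatically disjoint, since they lie in different lists. -/
theorem exists_isFlippingCycle_of_cycle {h : Finset (MarkedWord k)}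
    (hfst : Set.InjOn Prod.fst (h : Set (MarkedWord k)))
    (hsnd : Set.InjOn Prod.snd (h : Set (MarkedWord k))) {a : OddVertex k}
    {p : (oddGraph k).Walk a a} (hp : p.IsCycle) (hlen : p.length = 2 * h.card)
    (hex : ∀ m ∈ h, ∃ e ∈ p.edges, IsFlippableTuple m e) : ∃ C, IsFlippingCycle h C := by
  have : ∀ m, ∃ e, m ∈ h → e ∈ p.edges ∧ IsFlippableTuple m e := by
    intro m
    by_cases hm : m ∈ h
    · obtain ⟨e, he⟩ := hex m hm
      exact ⟨e, fun _ => he⟩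
    · exact ⟨s(a, a), fun h => absurd h hm⟩
  choose e he using this
  refine ⟨{e | e ∈ p.edges}, hfst, hsnd, ⟨a, p, hp, rfl⟩, by rw [ncard_edges_of_isCycle hp, hlen],
    e, fun m hm => ⟨(he m hm).2, (he m hm).1⟩, fun m hm m' hm' hne v hv hv' => hne ?_⟩
  exact hfst hm hm' (((he m hm).2.listIndex_eq hv).symm.trans ((he m' hm').2.listIndex_eq hv'))

theorem exists_isFlippingCycle_three (hk : 3 ≤ k) {h : Finset (MarkedWord k)}
    {m₁ m₂ m₃ : MarkedWord k} (hm : ∀ m, m ∈ h ↔ m = m₁ ∨ m = m₂ ∨ m = m₃)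
    (h₁ : [m₁.1, m₂.1, m₃.1].Nodup) (h₂ : [m₁.2, m₂.2, m₃.2].Nodup)
    {a₁ b₁ a₂ b₂ a₃ b₃ : OddVertex k} (e₁ : IsFlippableTuple m₁ s(a₁, b₁))
    (e₂ : IsFlippableTuple m₂ s(a₂, b₂)) (e₃ : IsFlippableTuple m₃ s(a₃, b₃))
    (d₁ : Disjoint b₁.1 a₂.1) (d₂ : Disjoint b₂.1 a₃.1) (d₃ : Disjoint b₃.1 a₁.1) :
    ∃ C, IsFlippingCycle h C := by
  classical
  have hadj : ∀ {x y : OddVertex k}, Disjoint x.1 y.1 → (oddGraph k).Adj x y := fun h =>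
    (oddGraph_adj_iff (by omega)).2 h
  simp only [List.nodup_cons, List.mem_cons, List.not_mem_nil, or_false, not_or, not_false_eq_true,
    List.nodup_nil, and_true] at h₁ h₂
  obtain ⟨⟨h12, h13⟩, h23⟩ := h₁
  obtain ⟨⟨g12, g13⟩, g23⟩ := h₂
  have hcard : h.card = 3 := by
    have : h = {m₁, m₂, m₃} := by ext m; simp [hm]
    rw [this, Finset.card_eq_three]
    exact ⟨m₁, m₂, m₃, by grind, by grind, by grind, rfl⟩
  have n₁ := (e₁.adj hk).ne
  have n₂ := (e₂.adj hk).ne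
  have n₃ := (e₃.adj hk).ne
  have i₁ := e₁.listIndex_eq (Sym2.mem_mk_left a₁ b₁)
  have i₂ := e₂.listIndex_eq (Sym2.mem_mk_left a₂ b₂)
  have i₃ := e₃.listIndex_eq (Sym2.mem_mk_left a₃ b₃)
  have j₁ := e₁.listIndex_eq (Sym2.mem_mk_right a₁ b₁)
  have j₂ := e₂.listIndex_eq (Sym2.mem_mk_right a₂ b₂)
  have j₃ := e₃.listIndex_eq (Sym2.mem_mk_right a₃ b₃)
  refine exists_isFlippingCycle_of_cycle (p := .cons (e₁.adj hk) (.cons (hadj d₁)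
    (.cons (e₂.adj hk) (.cons (hadj d₂) (.cons (e₃.adj hk) (.cons (hadj d₃) .nil))))))
    ?_ ?_ (isCycle_cons_of_nodup _ _ ?_ (by simp)) (by simp [hcard]) ?_
  · intro m h m' h' e
    rw [Finset.mem_coe, hm] at h h'
    rcases h with rfl | rfl | rfl <;> rcases h' with rfl | rfl | rfl <;>
      first | rfl | exact absurd e h12 | exact absurd e.symm h12 | exact absurd e h13 | exact absurd e.symm h13 | exact absurd e h23 | exact absurd e.symm h23
  · intro m h m' h' e
    rw [Finset.mem_coe, hm] at h h'
    rcases h with rfl | rfl | rfl <;> rcases h' with rfl | rfl | rfl <;>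
      first | rfl | exact absurd e g12 | exact absurd e.symm g12 | exact absurd e g13 | exact absurd e.symm g13 | exact absurd e g23 | exact absurd e.symm g23
  · simp only [Walk.support_cons, Walk.support_nil, List.nodup_cons, List.mem_cons,
      List.not_mem_nil, or_false, not_or, not_false_eq_true, List.nodup_nil, and_true]
    and_intros <;> first | exact n₁ | exact n₁.symm | exact n₂ | exact n₂.symm | exact n₃ | exact n₃.symm | skip
    all_goals
      intro e
      replace e := congrArg listIndex e
      simp only [i₁, i₂, i₃, j₁, j₂, j₃] at e
      first | exact absurd e h12 | exact absurd e.symm h12 | exact absurd e h13 | exact absurd e.symm h13 | exact absurd e h23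
  · intro m h
    rcases (hm m).1 h with rfl | rfl | rfl
    · exact ⟨_, by simp, e₁⟩
    · exact ⟨_, by simp, e₂⟩
    · exact ⟨_, by simp, e₃⟩

theorem exists_isFlippingCycle_four (hk : 3 ≤ k) {h : Finset (MarkedWord k)}
    {m₁ m₂ m₃ m₄ : MarkedWord k} (hm : ∀ m, m ∈ h ↔ m = m₁ ∨ m = m₂ ∨ m = m₃ ∨ m = m₄)
    (h₁ : [m₁.1, m₂.1, m₃.1, m₄.1].Nodup) (h₂ : [m₁.2, m₂.2, m₃.2, m₄.2].Nodup)
    {a₁ b₁ a₂ b₂ a₃ b₃ a₄ b₄ : OddVertex k} (e₁ : IsFlippableTuple m₁ s(a₁, b₁))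
    (e₂ : IsFlippableTuple m₂ s(a₂, b₂)) (e₃ : IsFlippableTuple m₃ s(a₃, b₃))
    (e₄ : IsFlippableTuple m₄ s(a₄, b₄))
    (d₁ : Disjoint b₁.1 a₂.1) (d₂ : Disjoint b₂.1 a₃.1) (d₃ : Disjoint b₃.1 a₄.1)
    (d₄ : Disjoint b₄.1 a₁.1) :
    ∃ C, IsFlippingCycle h C := by
  classical
  have hadj : ∀ {x y : OddVertex k}, Disjoint x.1 y.1 → (oddGraph k).Adj x y := fun h =>
    (oddGraph_adj_iff (by omega)).2 h
  simp only [List.nodup_cons, List.mem_cons, List.not_mem_nil, or_false, not_or, not_false_eq_true,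
    List.nodup_nil, and_true] at h₁ h₂
  obtain ⟨⟨h12, h13, h14⟩, ⟨h23, h24⟩, h34⟩ := h₁
  obtain ⟨⟨g12, g13, g14⟩, ⟨g23, g24⟩, g34⟩ := h₂
  have hcard : h.card = 4 := by
    have : h = {m₁, m₂, m₃, m₄} := by ext m; simp [hm]
    rw [this, Finset.card_insert_of_notMem, Finset.card_eq_three.2
      ⟨m₂, m₃, m₄, by grind, by grind, by grind, rfl⟩]
    grind
  have n₁ := (e₁.adj hk).ne
  have n₂ := (e₂.adj hk).ne
  have n₃ := (e₃.adj hk).ne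
  have n₄ := (e₄.adj hk).ne
  have i₁ := e₁.listIndex_eq (Sym2.mem_mk_left a₁ b₁)
  have i₂ := e₂.listIndex_eq (Sym2.mem_mk_left a₂ b₂)
  have i₃ := e₃.listIndex_eq (Sym2.mem_mk_left a₃ b₃)
  have i₄ := e₄.listIndex_eq (Sym2.mem_mk_left a₄ b₄)
  have j₁ := e₁.listIndex_eq (Sym2.mem_mk_right a₁ b₁)
  have j₂ := e₂.listIndex_eq (Sym2.mem_mk_right a₂ b₂)
  have j₃ := e₃.listIndex_eq (Sym2.mem_mk_right a₃ b₃)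
  have j₄ := e₄.listIndex_eq (Sym2.mem_mk_right a₄ b₄)
  refine exists_isFlippingCycle_of_cycle (p := .cons (e₁.adj hk) (.cons (hadj d₁)
    (.cons (e₂.adj hk) (.cons (hadj d₂) (.cons (e₃.adj hk) (.cons (hadj d₃)
    (.cons (e₄.adj hk) (.cons (hadj d₄) .nil))))))))
    ?_ ?_ (isCycle_cons_of_nodup _ _ ?_ (by simp)) (by simp [hcard]) ?_
  · intro m h m' h' e
    rw [Finset.mem_coe, hm] at h h'
    rcases h with rfl | rfl | rfl | rfl <;> rcases h' with rfl | rfl | rfl | rfl <;>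
      first | rfl | exact absurd e h12 | exact absurd e.symm h12 | exact absurd e h13 | exact absurd e.symm h13 | exact absurd e h14 | exact absurd e.symm h14 | exact absurd e h23 | exact absurd e.symm h23 | exact absurd e h24 | exact absurd e.symm h24 | exact absurd e h34 | exact absurd e.symm h34
  · intro m h m' h' e
    rw [Finset.mem_coe, hm] at h h'
    rcases h with rfl | rfl | rfl | rfl <;> rcases h' with rfl | rfl | rfl | rfl <;>
      first | rfl | exact absurd e g12 | exact absurd e.symm g12 | exact absurd e g13 | exact absurd e.symm g13 | exact absurd e g14 | exact absurd e.symm g14 | exact absurd e g23 | exact absurd e.symm g23 | exact absurd e g24 | exact absurd e.symm g24 | exact absurd e g34 | exact absurd e.symm g34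
  · simp only [Walk.support_cons, Walk.support_nil, List.nodup_cons, List.mem_cons,
      List.not_mem_nil, or_false, not_or, not_false_eq_true, List.nodup_nil, and_true]
    and_intros <;> first | exact n₁ | exact n₁.symm | exact n₂ | exact n₂.symm | exact n₃ | exact n₃.symm | exact n₄ | exact n₄.symm | skip
    all_goals
      intro e
      replace e := congrArg listIndex e
      simp only [i₁, i₂, i₃, i₄, j₁, j₂, j₃, j₄] at e
      first | exact absurd e h12 | exact absurd e.symm h12 | exact absurd e h13 | exact absurd e.symm h13 | exact absurd e h14 | exact absurd e.symm h14 | exact absurd e h23 | exact absurd e.symm h23 | exact absurd e h24 | exact absurd e.symm h24 | exact absurd e h34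
  · intro m h
    rcases (hm m).1 h with rfl | rfl | rfl | rfl
    · exact ⟨_, by simp, e₁⟩
    · exact ⟨_, by simp, e₂⟩
    · exact ⟨_, by simp, e₃⟩
    · exact ⟨_, by simp, e₄⟩

end MiddleLevels

namespace MiddleLevels

open DyckStep SimpleGraph

variable {k : ℕ}

/-- The frame appears complemented on one side and unchanged on the other, so it cannot produce a
common one. -/
theorem Follows.disjoint {z w : List DyckStep × List DyckStep} (h : Follows z w) (n : ℕ)
    (P Q : List DyckStep) :
    Disjoint (onesSet n (D :: (P ++ z.1).map flipStep ++ U :: (z.2 ++ Q).map flipStep))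
      (onesSet n (U :: (P ++ w.1) ++ U :: (w.2 ++ Q))) := by
  have h0 : NoCommonOne [D] [U] := List.Forall₂.cons (by simp) List.Forall₂.nil
  have := ((h0.append (noCommonOne_complement P)).append
    (NoCommonOne.append h (noCommonOne_complement Q))).disjoint n
  simpa using this

/-- Deleting the Dyck factor `x` leaves the Dyck word `uv`, and the frame of `uv` serves all words
of a hyperedge simultaneously. -/
theorem exists_tuples {u v : List DyckStep} {x : DyckWord} {f : Word k}
    (hf : f.1.toList = u ++ x.toList ++ v) :
    ∃ (b : Bool) (P Q : List DyckStep), ∀ (g : Word k) (y : DyckWord),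
      g.1.toList = u ++ y.toList ++ v → ∀ z : List DyckStep × List DyckStep,
      IsWindow b y z.1 z.2 → ∃ α β : OddVertex k,
        α.1 = onesSet (2 * k + 1) (U :: (P ++ z.1) ++ U :: (z.2 ++ Q)) ∧
        β.1 = onesSet (2 * k + 1) (D :: (P ++ z.1).map flipStep ++ U :: (z.2 ++ Q).map flipStep) ∧
        IsFlippableTuple (g, z.2.length + v.length) s(α, β) := by
  obtain ⟨F, hF⟩ := exists_remove hf
  obtain ⟨b, P, Q, hQ, hw⟩ := exists_frame F u v hF true
  refine ⟨b, P, Q, fun g y hg z hz => ?_⟩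
  obtain ⟨α, β, h1, h2, h3⟩ := exists_flippableTuple g (hw y g.1 hg _ _ hz)
  rw [List.length_append, hQ] at h3
  exact ⟨α, β, h1, h2, h3⟩

theorem markedWord_ext {m m' : MarkedWord k} (h₁ : m.1.1.toList = m'.1.1.toList)
    (h₂ : m.2 = m'.2) : m = m' :=
  Prod.ext (Subtype.ext (DyckWord.ext h₁)) h₂

/-- The orientation `b` depends on the depth at which the pattern is inserted, so `hw` has to supply
windows for both values. For the windows used below, changing `b` complements them, which reverses
the relation `Follows`; hence the reversed order for `false`. -/
theorem exists_isFlippingCycle_of_windows_three (hk : 3 ≤ k) {h : Finset (MarkedWord k)}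
    {u v : List DyckStep} {x₁ x₂ x₃ : DyckWord} {j₁ j₂ j₃ : ℕ}
    (him : (fun m : MarkedWord k => (m.1.1.toList, m.2)) '' (h : Set (MarkedWord k)) =
      {y | ∃ x ∈ [(x₁.toList, j₁), (x₂.toList, j₂), (x₃.toList, j₃)],
        y = (u ++ x.1 ++ v, x.2 + v.length)})
    (hx : [x₁.toList, x₂.toList, x₃.toList].Nodup) (hj : [j₁, j₂, j₃].Nodup)
    (hw : ∀ b, ∃ z₁ z₂ z₃ : List DyckStep × List DyckStep, IsWindow b x₁ z₁.1 z₁.2 ∧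
      IsWindow b x₂ z₂.1 z₂.2 ∧ IsWindow b x₃ z₃.1 z₃.2 ∧ z₁.2.length = j₁ ∧ z₂.2.length = j₂ ∧
      z₃.2.length = j₃ ∧ if b then Follows z₁ z₂ ∧ Follows z₂ z₃ ∧ Follows z₃ z₁
        else Follows z₂ z₁ ∧ Follows z₃ z₂ ∧ Follows z₁ z₃) : ∃ C, IsFlippingCycle h C := by
  have hmem : ∀ y, (y = (x₁.toList, j₁) ∨ y = (x₂.toList, j₂) ∨ y = (x₃.toList, j₃)) →
      ∃ m ∈ h, m.1.1.toList = u ++ y.1 ++ v ∧ m.2 = y.2 + v.length := by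
    intro y hy
    have : (u ++ y.1 ++ v, y.2 + v.length) ∈
        (fun m : MarkedWord k => (m.1.1.toList, m.2)) '' (h : Set (MarkedWord k)) := by
      rw [him]; exact ⟨y, by simpa using hy, rfl⟩
    obtain ⟨m, hm, e⟩ := this
    exact ⟨m, hm, congrArg Prod.fst e, congrArg Prod.snd e⟩
  obtain ⟨⟨f₁, i₁⟩, hm₁, s₁, t₁⟩ := hmem _ (Or.inl rfl)
  obtain ⟨⟨f₂, i₂⟩, hm₂, s₂, t₂⟩ := hmem _ (Or.inr (Or.inl rfl))
  obtain ⟨⟨f₃, i₃⟩, hm₃, s₃, t₃⟩ := hmem _ (Or.inr (Or.inr rfl))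
  have hm : ∀ m, m ∈ h ↔ m = (f₁, i₁) ∨ m = (f₂, i₂) ∨ m = (f₃, i₃) := by
    intro m
    constructor
    · intro hmh
      have := him.subset ⟨m, hmh, rfl⟩
      obtain ⟨x, hx, e⟩ := this
      have e₁ := congrArg Prod.fst e
      have e₂ := congrArg Prod.snd e
      simp only [List.mem_cons, List.not_mem_nil, or_false] at hx
      rcases hx with rfl | rfl | rfl
      · exact Or.inl (markedWord_ext (e₁.trans s₁.symm) (e₂.trans t₁.symm))
      · exact Or.inr (Or.inl (markedWord_ext (e₁.trans s₂.symm) (e₂.trans t₂.symm)))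
      · exact Or.inr (Or.inr (markedWord_ext (e₁.trans s₃.symm) (e₂.trans t₃.symm)))
    · rintro (rfl | rfl | rfl) <;> assumption
  have n₁ : [f₁, f₂, f₃].Nodup := by
    refine List.Nodup.of_map (fun f : Word k => f.1.toList) ?_
    simp only [List.map_cons, List.map_nil]
    rw [s₁, s₂, s₃]
    exact hx.map (f := fun x => u ++ x ++ v) fun a b e => by simpa using e
  have n₂ : [i₁, i₂, i₃].Nodup := by
    simp only at t₁ t₂ t₃
    rw [t₁, t₂, t₃]
    exact hj.map (f := fun j => j + v.length) fun a b e => by simpa using e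
  obtain ⟨b, P, Q, hPQ⟩ := exists_tuples s₁
  obtain ⟨z₁, z₂, z₃, w₁, w₂, w₃, l₁, l₂, l₃, hz⟩ := hw b
  obtain ⟨α₁, β₁, p₁, q₁, r₁⟩ := hPQ f₁ x₁ s₁ z₁ w₁
  obtain ⟨α₂, β₂, p₂, q₂, r₂⟩ := hPQ f₂ x₂ s₂ z₂ w₂
  obtain ⟨α₃, β₃, p₃, q₃, r₃⟩ := hPQ f₃ x₃ s₃ z₃ w₃
  rw [l₁, ← t₁] at r₁
  rw [l₂, ← t₂] at r₂
  rw [l₃, ← t₃] at r₃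
  cases b
  -- Exchanging the ends of each tuple traverses the hexagon in the opposite direction.
  · rw [Sym2.eq_swap] at r₁ r₂ r₃
    refine exists_isFlippingCycle_three hk hm n₁ n₂ r₁ r₂ r₃ ?_ ?_ ?_
    · rw [p₁, q₂]; exact (hz.1.disjoint _ P Q).symm
    · rw [p₂, q₃]; exact (hz.2.1.disjoint _ P Q).symm
    · rw [p₃, q₁]; exact (hz.2.2.disjoint _ P Q).symm
  · refine exists_isFlippingCycle_three hk hm n₁ n₂ r₁ r₂ r₃ ?_ ?_ ?_
    · rw [p₂, q₁]; exact hz.1.disjoint _ P Q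
    · rw [p₃, q₂]; exact hz.2.1.disjoint _ P Q
    · rw [p₁, q₃]; exact hz.2.2.disjoint _ P Q

theorem exists_isFlippingCycle_of_windows_four (hk : 3 ≤ k) {h : Finset (MarkedWord k)}
    {u v : List DyckStep} {x₁ x₂ x₃ x₄ : DyckWord} {j₁ j₂ j₃ j₄ : ℕ}
    (him : (fun m : MarkedWord k => (m.1.1.toList, m.2)) '' (h : Set (MarkedWord k)) =
      {y | ∃ x ∈ [(x₁.toList, j₁), (x₂.toList, j₂), (x₃.toList, j₃), (x₄.toList, j₄)],
        y = (u ++ x.1 ++ v, x.2 + v.length)})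
    (hx : [x₁.toList, x₂.toList, x₃.toList, x₄.toList].Nodup) (hj : [j₁, j₂, j₃, j₄].Nodup)
    (hw : ∀ b, ∃ z₁ z₂ z₃ z₄ : List DyckStep × List DyckStep, IsWindow b x₁ z₁.1 z₁.2 ∧
      IsWindow b x₂ z₂.1 z₂.2 ∧ IsWindow b x₃ z₃.1 z₃.2 ∧ IsWindow b x₄ z₄.1 z₄.2 ∧
      z₁.2.length = j₁ ∧ z₂.2.length = j₂ ∧ z₃.2.length = j₃ ∧ z₄.2.length = j₄ ∧
      if b then Follows z₁ z₂ ∧ Follows z₂ z₃ ∧ Follows z₃ z₄ ∧ Follows z₄ z₁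
        else Follows z₂ z₁ ∧ Follows z₃ z₂ ∧ Follows z₄ z₃ ∧ Follows z₁ z₄) :
    ∃ C, IsFlippingCycle h C := by
  have hmem : ∀ y, (y = (x₁.toList, j₁) ∨ y = (x₂.toList, j₂) ∨ y = (x₃.toList, j₃) ∨
      y = (x₄.toList, j₄)) → ∃ m ∈ h, m.1.1.toList = u ++ y.1 ++ v ∧ m.2 = y.2 + v.length := by
    intro y hy
    have : (u ++ y.1 ++ v, y.2 + v.length) ∈
        (fun m : MarkedWord k => (m.1.1.toList, m.2)) '' (h : Set (MarkedWord k)) := by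
      rw [him]; exact ⟨y, by simpa using hy, rfl⟩
    obtain ⟨m, hm, e⟩ := this
    exact ⟨m, hm, congrArg Prod.fst e, congrArg Prod.snd e⟩
  obtain ⟨⟨f₁, i₁⟩, hm₁, s₁, t₁⟩ := hmem _ (Or.inl rfl)
  obtain ⟨⟨f₂, i₂⟩, hm₂, s₂, t₂⟩ := hmem _ (Or.inr (Or.inl rfl))
  obtain ⟨⟨f₃, i₃⟩, hm₃, s₃, t₃⟩ := hmem _ (Or.inr (Or.inr (Or.inl rfl)))
  obtain ⟨⟨f₄, i₄⟩, hm₄, s₄, t₄⟩ := hmem _ (Or.inr (Or.inr (Or.inr rfl)))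
  have hm : ∀ m, m ∈ h ↔ m = (f₁, i₁) ∨ m = (f₂, i₂) ∨ m = (f₃, i₃) ∨ m = (f₄, i₄) := by
    intro m
    constructor
    · intro hmh
      have := him.subset ⟨m, hmh, rfl⟩
      obtain ⟨x, hx, e⟩ := this
      have e₁ := congrArg Prod.fst e
      have e₂ := congrArg Prod.snd e
      simp only [List.mem_cons, List.not_mem_nil, or_false] at hx
      rcases hx with rfl | rfl | rfl | rfl
      · exact Or.inl (markedWord_ext (e₁.trans s₁.symm) (e₂.trans t₁.symm))
      · exact Or.inr (Or.inl (markedWord_ext (e₁.trans s₂.symm) (e₂.trans t₂.symm)))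
      · exact Or.inr (Or.inr (Or.inl (markedWord_ext (e₁.trans s₃.symm) (e₂.trans t₃.symm))))
      · exact Or.inr (Or.inr (Or.inr (markedWord_ext (e₁.trans s₄.symm) (e₂.trans t₄.symm))))
    · rintro (rfl | rfl | rfl | rfl) <;> assumption
  have n₁ : [f₁, f₂, f₃, f₄].Nodup := by
    refine List.Nodup.of_map (fun f : Word k => f.1.toList) ?_
    simp only [List.map_cons, List.map_nil]
    rw [s₁, s₂, s₃, s₄]
    exact hx.map (f := fun x => u ++ x ++ v) fun a b e => by simpa using e
  have n₂ : [i₁, i₂, i₃, i₄].Nodup := by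
    simp only at t₁ t₂ t₃ t₄
    rw [t₁, t₂, t₃, t₄]
    exact hj.map (f := fun j => j + v.length) fun a b e => by simpa using e
  obtain ⟨b, P, Q, hPQ⟩ := exists_tuples s₁
  obtain ⟨z₁, z₂, z₃, z₄, w₁, w₂, w₃, w₄, l₁, l₂, l₃, l₄, hz⟩ := hw b
  obtain ⟨α₁, β₁, p₁, q₁, r₁⟩ := hPQ f₁ x₁ s₁ z₁ w₁
  obtain ⟨α₂, β₂, p₂, q₂, r₂⟩ := hPQ f₂ x₂ s₂ z₂ w₂
  obtain ⟨α₃, β₃, p₃, q₃, r₃⟩ := hPQ f₃ x₃ s₃ z₃ w₃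
  obtain ⟨α₄, β₄, p₄, q₄, r₄⟩ := hPQ f₄ x₄ s₄ z₄ w₄
  rw [l₁, ← t₁] at r₁
  rw [l₂, ← t₂] at r₂
  rw [l₃, ← t₃] at r₃
  rw [l₄, ← t₄] at r₄
  cases b
  · rw [Sym2.eq_swap] at r₁ r₂ r₃ r₄
    refine exists_isFlippingCycle_four hk hm n₁ n₂ r₁ r₂ r₃ r₄ ?_ ?_ ?_ ?_
    · rw [p₁, q₂]; exact (hz.1.disjoint _ P Q).symm
    · rw [p₂, q₃]; exact (hz.2.1.disjoint _ P Q).symm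
    · rw [p₃, q₄]; exact (hz.2.2.1.disjoint _ P Q).symm
    · rw [p₄, q₁]; exact (hz.2.2.2.disjoint _ P Q).symm
  · refine exists_isFlippingCycle_four hk hm n₁ n₂ r₁ r₂ r₃ r₄ ?_ ?_ ?_ ?_
    · rw [p₂, q₁]; exact hz.1.disjoint _ P Q
    · rw [p₃, q₂]; exact hz.2.1.disjoint _ P Q
    · rw [p₄, q₃]; exact hz.2.2.1.disjoint _ P Q
    · rw [p₁, q₄]; exact hz.2.2.2.disjoint _ P Q

/-! ### The patterns -/

@[simp] theorem length_complementIf (c : Bool) (l : List DyckStep) :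
    (complementIf c l).length = l.length := by cases c <;> simp

@[simp] theorem noCommonOne_nil : NoCommonOne [] [] := List.Forall₂.nil

@[simp] theorem noCommonOne_cons {a b : DyckStep} {l l' : List DyckStep} :
    NoCommonOne (a :: l) (b :: l') ↔ (a = U ∨ b = U) ∧ NoCommonOne l l' :=
  List.forall₂_cons

theorem noCommonOne_append_complement {l l' : List DyckStep} (w : List DyckStep)
    (h : NoCommonOne l l') : NoCommonOne (w ++ l) (w.map flipStep ++ l') :=
  (noCommonOne_complement' w).append h

theorem noCommonOne_complement_append {l l' : List DyckStep} (w : List DyckStep)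
    (h : NoCommonOne l l') : NoCommonOne (w.map flipStep ++ l) (w ++ l') :=
  (noCommonOne_complement w).append h

/-- Here and for the other patterns, each window term spells out the place of the underlined letter:
whether it opens or closes its block, which siblings stand beside it, and which blocks enclose it,
every enclosing block negating the orientation. What remains is a comparison of explicit strings. -/
theorem exists_isFlippingCycle_S2 (hk : 3 ≤ k) {h : Finset (MarkedWord k)}
    {u v : List DyckStep}
    (him : (fun m : MarkedWord k => (m.1.1.toList, m.2)) '' (h : Set (MarkedWord k)) =
      {y | ∃ x ∈ S2, y = (u ++ x.1 ++ v, x.2 + v.length)}) :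
    ∃ C, IsFlippingCycle h C := by
  refine exists_isFlippingCycle_of_windows_three hk (u := u) (v := v)
    (x₁ := .nest (.nest 0) + .nest (.nest 0)) (x₂ := .nest (.nest 0 + .nest (.nest 0))) (x₃ := .nest (.nest (.nest 0 + .nest 0)))
    (j₁ := 6) (j₂ := 0) (j₃ := 2)
    (him.trans (by simp [S2, bits])) (by simp) (by simp) fun b => ?_
  refine ⟨(_, _), (_, _), (_, _),
    (isWindow_opening (!b) _).nest.add_right _,
    isWindow_closing b _,
    ((isWindow_closing (!!b) _).add_left _).nest.nest,
    by simp, by simp, by simp, ?_⟩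
  cases b <;> simp [Follows]

theorem exists_isFlippingCycle_S2_reverseComplement (hk : 3 ≤ k) {h : Finset (MarkedWord k)}
    {u v : List DyckStep}
    (him : (fun m : MarkedWord k => (m.1.1.toList, m.2)) '' (h : Set (MarkedWord k)) =
      {y | ∃ x ∈ S2.map reverseComplement, y = (u ++ x.1 ++ v, x.2 + v.length)}) :
    ∃ C, IsFlippingCycle h C := by
  refine exists_isFlippingCycle_of_windows_three hk (u := u) (v := v)
    (x₁ := .nest (.nest 0) + .nest (.nest 0)) (x₂ := .nest (.nest (.nest 0) + .nest 0)) (x₃ := .nest (.nest (.nest 0 + .nest 0)))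
    (j₁ := 1) (j₂ := 7) (j₃ := 5)
    (him.trans (by simp [S2, bits, reverseComplement])) (by simp) (by simp) fun b => ?_
  refine ⟨(_, _), (_, _), (_, _),
    (isWindow_closing (!b) _).nest.add_left _,
    isWindow_opening b _,
    ((isWindow_opening (!!b) _).add_right _).nest.nest,
    by simp, by simp, by simp, ?_⟩
  cases b <;> simp [Follows]

theorem exists_isFlippingCycle_S3 (hk : 3 ≤ k) {h : Finset (MarkedWord k)}
    {u v : List DyckStep}
    (him : (fun m : MarkedWord k => (m.1.1.toList, m.2)) '' (h : Set (MarkedWord k)) =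
      {y | ∃ x ∈ S3, y = (u ++ x.1 ++ v, x.2 + v.length)}) :
    ∃ C, IsFlippingCycle h C := by
  refine exists_isFlippingCycle_of_windows_three hk (u := u) (v := v)
    (x₁ := .nest (.nest (.nest 0))) (x₂ := .nest 0 + .nest (.nest 0)) (x₃ := .nest 0 + .nest 0 + .nest 0)
    (j₁ := 0) (j₂ := 1) (j₃ := 5)
    (him.trans (by simp [S3, bits])) (by simp) (by simp) fun b => ?_
  refine ⟨(_, _), (_, _), (_, _),
    isWindow_closing b _,
    (isWindow_closing (!b) _).nest.add_left _,
    ((isWindow_opening b _).add_right _).add_right _,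
    by simp, by simp, by simp, ?_⟩
  cases b <;> simp [Follows]

theorem exists_isFlippingCycle_S3_reverseComplement (hk : 3 ≤ k) {h : Finset (MarkedWord k)}
    {u v : List DyckStep}
    (him : (fun m : MarkedWord k => (m.1.1.toList, m.2)) '' (h : Set (MarkedWord k)) =
      {y | ∃ x ∈ S3.map reverseComplement, y = (u ++ x.1 ++ v, x.2 + v.length)}) :
    ∃ C, IsFlippingCycle h C := by
  refine exists_isFlippingCycle_of_windows_three hk (u := u) (v := v)
    (x₁ := .nest (.nest (.nest 0))) (x₂ := .nest (.nest 0) + .nest 0) (x₃ := .nest 0 + .nest 0 + .nest 0)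
    (j₁ := 5) (j₂ := 4) (j₃ := 0)
    (him.trans (by simp [S3, bits, reverseComplement])) (by simp) (by simp) fun b => ?_
  refine ⟨(_, _), (_, _), (_, _),
    isWindow_opening b _,
    (isWindow_opening (!b) _).nest.add_right _,
    (isWindow_closing b _).add_left _,
    by simp, by simp, by simp, ?_⟩
  cases b <;> simp [Follows]

theorem exists_isFlippingCycle_S4 (hk : 3 ≤ k) {h : Finset (MarkedWord k)}
    {u v : List DyckStep}
    (him : (fun m : MarkedWord k => (m.1.1.toList, m.2)) '' (h : Set (MarkedWord k)) =
      {y | ∃ x ∈ S4, y = (u ++ x.1 ++ v, x.2 + v.length)}) :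
    ∃ C, IsFlippingCycle h C := by
  refine exists_isFlippingCycle_of_windows_four hk (u := u) (v := v)
    (x₁ := .nest (.nest (.nest 0))) (x₂ := .nest (.nest 0 + .nest 0)) (x₃ := .nest 0 + .nest (.nest 0)) (x₄ := .nest 0 + .nest 0 + .nest 0)
    (j₁ := 0) (j₂ := 1) (j₃ := 3) (j₄ := 5)
    (him.trans (by simp [S4, bits])) (by simp) (by simp) fun b => ?_
  refine ⟨(_, _), (_, _), (_, _), (_, _),
    isWindow_closing b _,
    ((isWindow_closing (!b) _).add_left _).nest,
    (isWindow_opening b _).add_left _,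
    ((isWindow_opening b _).add_right _).add_right _,
    by simp, by simp, by simp, by simp, ?_⟩
  cases b <;> simp [Follows]

theorem exists_isFlippingCycle_S4_reverseComplement (hk : 3 ≤ k) {h : Finset (MarkedWord k)}
    {u v : List DyckStep}
    (him : (fun m : MarkedWord k => (m.1.1.toList, m.2)) '' (h : Set (MarkedWord k)) =
      {y | ∃ x ∈ S4.map reverseComplement, y = (u ++ x.1 ++ v, x.2 + v.length)}) :
    ∃ C, IsFlippingCycle h C := by
  refine exists_isFlippingCycle_of_windows_four hk (u := u) (v := v)
    (x₁ := .nest (.nest (.nest 0))) (x₂ := .nest (.nest 0 + .nest 0)) (x₃ := .nest (.nest 0) + .nest 0) (x₄ := .nest 0 + .nest 0 + .nest 0)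
    (j₁ := 5) (j₂ := 4) (j₃ := 2) (j₄ := 0)
    (him.trans (by simp [S4, bits, reverseComplement])) (by simp) (by simp) fun b => ?_
  refine ⟨(_, _), (_, _), (_, _), (_, _),
    isWindow_opening b _,
    ((isWindow_opening (!b) _).add_right _).nest,
    (isWindow_closing b _).add_right _,
    (isWindow_closing b _).add_left _,
    by simp, by simp, by simp, by simp, ?_⟩
  cases b <;> simp [Follows]

/-- All three windows contain the same copy of `w`, complemented or not depending on `b`, at the
same place. In `Follows` it therefore always faces its own complement, and its content does not
matter. -/
theorem exists_isFlippingCycle_S1 (hk : 3 ≤ k) (w : DyckWord) {h : Finset (MarkedWord k)}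
    {u v : List DyckStep}
    (him : (fun m : MarkedWord k => (m.1.1.toList, m.2)) '' (h : Set (MarkedWord k)) =
      {y | ∃ x ∈ S1 w, y = (u ++ x.1 ++ v, x.2 + v.length)}) :
    ∃ C, IsFlippingCycle h C := by
  refine exists_isFlippingCycle_of_windows_three hk (u := u) (v := v)
    (x₁ := .nest (w + .nest (.nest 0))) (x₂ := .nest (w + .nest 0) + .nest 0) (x₃ := .nest (w + .nest 0 + .nest 0))
    (j₁ := 1) (j₂ := 4) (j₃ := 0)
    (him.trans (by simp [S1, bits])) (by simp) (by simp) fun b => ?_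
  refine ⟨(_, _), (_, _), (_, _),
    ((isWindow_closing (!b) _).add_left _).nest,
    ((isWindow_opening (!b) _).add_left _).nest.add_right _,
    isWindow_closing b _,
    by simp, by simp, by simp, ?_⟩
  cases b <;> simp [Follows, Function.comp_def, noCommonOne_append_complement,
    noCommonOne_complement_append]

theorem exists_isFlippingCycle_S1_reverseComplement (hk : 3 ≤ k) (w : DyckWord) {h : Finset (MarkedWord k)}
    {u v : List DyckStep}
    (him : (fun m : MarkedWord k => (m.1.1.toList, m.2)) '' (h : Set (MarkedWord k)) =
      {y | ∃ x ∈ (S1 w).map reverseComplement, y = (u ++ x.1 ++ v, x.2 + v.length)}) :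
    ∃ C, IsFlippingCycle h C := by
  -- `w'` is the reversed complement of `w`; it now stands to the right of the underlined letter, so
  -- the positions depend on its length.
  obtain ⟨w', hw'⟩ := exists_dyckWord_reverse w
  have hr : (w.toList.map flipStep).reverse = w'.toList := by
    rw [← List.map_reverse, ← hw']
    simp [Function.comp_def]
  have hl : w.toList.length = w'.toList.length := by rw [← hr]; simp
  refine exists_isFlippingCycle_of_windows_three hk (u := u) (v := v)
    (x₁ := .nest (.nest (.nest 0) + w')) (x₂ := .nest 0 + .nest (.nest 0 + w')) (x₃ := .nest (.nest 0 + .nest 0 + w'))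
    (j₁ := w'.toList.length + 4) (j₂ := w'.toList.length + 1) (j₃ := w'.toList.length + 5)
    (him.trans (by simp [S1, bits, reverseComplement, hr, hl])) (by simp) (by simp) fun b => ?_
  refine ⟨(_, _), (_, _), (_, _),
    ((isWindow_opening (!b) _).add_right _).nest,
    ((isWindow_closing (!b) _).add_right _).nest.add_left _,
    isWindow_opening b _,
    by simp; omega, by simp, by simp, ?_⟩
  cases b <;> simp [Follows, Function.comp_def, noCommonOne_append_complement,
    noCommonOne_complement_append]

theorem exists_isFlippingCycle (hk : 3 ≤ k) {h : Finset (MarkedWord k)} (hh : h ∈ hyperedges k) :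
    ∃ C, IsFlippingCycle h C := by
  obtain ⟨S, ⟨T, hT, hS⟩, u, v, him⟩ := hh
  rcases hT with ⟨w, rfl⟩ | rfl | rfl | rfl <;> rcases hS with rfl | rfl
  · exact exists_isFlippingCycle_S1 hk w him
  · exact exists_isFlippingCycle_S1_reverseComplement hk w him
  · exact exists_isFlippingCycle_S2 hk him
  · exact exists_isFlippingCycle_S2_reverseComplement hk him
  · exact exists_isFlippingCycle_S3 hk him
  · exact exists_isFlippingCycle_S3_reverseComplement hk him
  · exact exists_isFlippingCycle_S4 hk him
  · exact exists_isFlippingCycle_S4_reverseComplement hk him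

end MiddleLevels

theorem mainTheorem2 (k : ℕ) (hk : 3 ≤ k) :
    (∀ h ∈ MiddleLevels.hyperedges k,
      (∃ D, MiddleLevels.IsFlippingCycle h D) ∧
      ∀ D, MiddleLevels.IsFlippingCycle h D → ∃ D', MiddleLevels.IsLift D D') ∧
    ∀ T : Set (Finset (MiddleLevels.MarkedWord k)),
      MiddleLevels.IsSpanningTree T → MiddleLevels.IsConflictFree T →
      ∀ D : Finset (MiddleLevels.MarkedWord k) → Set (Sym2 (MiddleLevels.OddVertex k)),
        (∀ h ∈ T, MiddleLevels.IsFlippingCycle h (D h)) →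
        MiddleLevels.IsHamiltonCycleEdgeSet (MiddleLevels.oddGraph k) (MiddleLevels.oddFlip T D) ∧
        ∀ D' : Finset (MiddleLevels.MarkedWord k) → Set (Sym2 (MiddleLevels.MiddleVertex k)),
          (∀ h ∈ T, MiddleLevels.IsLift (D h) (D' h)) →
          MiddleLevels.IsHamiltonCycleEdgeSet (MiddleLevels.middleGraph k)
            (MiddleLevels.middleFlip T D') := by
  refine ⟨fun h hh => ⟨MiddleLevels.exists_isFlippingCycle hk hh, fun D hD => ?_⟩,
    fun T hT hc D hD => MiddleLevels.hamilton_of_spanningTree hk hT hc hD⟩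
  obtain ⟨-, -, hcyc, hcard, -⟩ := hD
  -- Of a flipping cycle only its even length `2|h|` matters for lifting.
  exact MiddleLevels.exists_isLift (by omega) hcyc (hcard ▸ even_two_mul _)
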